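/- **Conventions.** Let $\varrho:\mathbb R\to\mathbb R$. A $\varrho$-matrix neural network ($\varrho$-MNN) is a nonempty finite tuple $\Phi=((\mathcal L^1,C^1,a^1),\dots,(\mathcal L^L,C^L,a^L))$, where $\mathcal L^\ell$ is a real tensor acting linearly from $N^{\ell-1,1}\times N^{\ell-1,2}$ matrices to $N^{\ell,1}\times N^{\ell,2}$ matrices, $C^\ell$ is an $N^{\ell,1}\times N^{\ell,2}$ matrix, and $a^\ell$ acts entrywise, each entry by either the identity or $\varrho$ if $\ell<L$, and by the identity if $\ell=L$. Its realization $R(\Phi)$ is the composition of the maps $A\mapsto a^\ell(\mathcal L^\ell A+C^\ell)$, $\ell=1,\dots,L$; $L(\Phi)=L$ is the number of layers, and the number of weights $M(\Phi)$ is the total number of nonzero entries of all $\mathcal L^\ell$ and $C^\ell$. $\|\cdot\|_2$ is the matrix norm induced by the Euclidean norm. **Theorem.** Suppose that for all $\varepsilon,K>0$ a $\varrho$-MNN $\Pi_{\varepsilon,K}$ with two scalar inputs and one scalar output is given such that $|xy-R(\Pi_{\varepsilon,K})(x,y)|\le\varepsilon$ for all $x,y\in[-K,K]$. Let $\varepsilon>0$,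 $\alpha\in\mathbb R\setminus\{0\}$, $\delta\in(0,1)$ and let $n\ge1$ be an integer. For $\eta>0$ put $$N(\eta,\delta)=\max\left\{\left\lceil\log_2\left(\frac{\log_2(\eta(1-\delta))}{\log_2\delta}\right)\right\rceil,1\right\}\ \text{ if }\eta(1-\delta)<1,\qquad N(\eta,\delta)=1\ \text{ if }\eta(1-\delta)\ge1,$$ $$\Sigma(\eta,\delta,n)=2^{-2^{N(\eta,\delta)}}\,\frac{\min\{\eta,1/4\}}{16n^3},$$ and write $N=N\left(\frac{\varepsilon}{2|\alpha|},\delta\right)$ and $\Pi=\Pi_{\Sigma(\varepsilon/|\alpha|,\delta,n),\,2n}$. Then there is a $\varrho$-MNN $\Phi$, with input and output in $\mathbb R^{n\times n}$, such that every $A\in\mathbb R^{n\times n}$ with $\|I_n-\alpha A\|_2\le\delta$ is invertible and satisfies $$\|A^{-1}-R(\Phi)(A)\|_2\le\varepsilon,$$ and such that: if $N\ge2$, then $$M(\Phi)\le 14\,n^{\log_2 7}(N-1)\big(M(\Pi)+12\big)+n^2\big(L(\Pi)-14N+20+2\log_2 n\big)+n(N+1),$$ $$L(\Phi)\le N\big[2\log_2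 n+5+L(\Pi)\big];$$ and if $N=1$, then $M(\Phi)=2(n^2+n)$ and $L(\Phi)=2$. -/

import Mathlib

open scoped Matrix.Norms.L2Operator

/-- The space `ℝ^((r × c) × (r₀ × c₀))` of tensors acting as linear maps from `r₀ × c₀` matrices
to `r × c` matrices. -/
abbrev MatTensor (r c r₀ c₀ : ℕ) : Type :=
  Fin r → Fin c → Fin r₀ → Fin c₀ → ℝ

namespace MatTensor

/-- The product of a tensor and a matrix. -/
def apply {r c r₀ c₀ : ℕ} (T : MatTensor r c r₀ c₀) (A : Matrix (Fin r₀) (Fin c₀) ℝ) :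
    Matrix (Fin r) (Fin c) ℝ :=
  Matrix.of fun i j => ∑ l, ∑ k, T i j k l * A k l

/-- The number of nonzero entries of a tensor. -/
noncomputable def numNonzero {r c r₀ c₀ : ℕ} (T : MatTensor r c r₀ c₀) : ℕ :=
  {p : Fin r × Fin c × Fin r₀ × Fin c₀ | T p.1 p.2.1 p.2.2.1 p.2.2.2 ≠ 0}.ncard

end MatTensor

/-- The number of nonzero entries of a matrix. -/
noncomputable def matNumNonzero {r c : ℕ} (C : Matrix (Fin r) (Fin c) ℝ) : ℕ :=
  {p : Fin r × Fin c | C p.1 p.2 ≠ 0}.ncard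

/-- Matrix neural networks with activation function `ϱ`. An element of `MNN ϱ r₀ c₀ r c` has input
in the `r₀ × c₀` matrices and output in the `r × c` matrices. It is a nonempty sequence of layers,
each with a tensor and a bias matrix; on a layer which is not the last one every entry
has its own activation function, either the identity or `ϱ`; the last layer has
the identity as activation. -/
inductive MNN (ϱ : ℝ → ℝ) : ℕ → ℕ → ℕ → ℕ → Type
  | last {r₀ c₀ r c : ℕ} (T : MatTensor r c r₀ c₀) (C : Matrix (Fin r) (Fin c) ℝ) :
      MNN ϱ r₀ c₀ r c
  | cons {r₀ c₀ r₁ c₁ r c : ℕ} (T : MatTensor r₁ c₁ r₀ c₀) (C : Matrix (Fin r₁) (Fin c₁) ℝ)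
      (act : Fin r₁ → Fin c₁ → ℝ → ℝ) (hact : ∀ i j, act i j = id ∨ act i j = ϱ)
      (Φ : MNN ϱ r₁ c₁ r c) : MNN ϱ r₀ c₀ r c

namespace MNN

variable {ϱ : ℝ → ℝ}

/-- The realization of a matrix neural network. -/
def realize : {r₀ c₀ r c : ℕ} → MNN ϱ r₀ c₀ r c →
    Matrix (Fin r₀) (Fin c₀) ℝ → Matrix (Fin r) (Fin c) ℝ
  | _, _, _, _, last T C, A => T.apply A + C
  | _, _, _, _, cons T C act _ Φ, A =>
      Φ.realize (Matrix.of fun i j => act i j ((T.apply A + C) i j))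

/-- The number of layers. -/
def numLayers : {r₀ c₀ r c : ℕ} → MNN ϱ r₀ c₀ r c → ℕ
  | _, _, _, _, last _ _ => 1
  | _, _, _, _, cons _ _ _ _ Φ => Φ.numLayers + 1

/-- The number of weights: the nonzero entries of all tensors and of all bias matrices. -/
noncomputable def numWeights : {r₀ c₀ r c : ℕ} → MNN ϱ r₀ c₀ r c → ℕ
  | _, _, _, _, last T C => T.numNonzero + matNumNonzero C
  | _, _, _, _, cons T C _ _ Φ => T.numNonzero + matNumNonzero C + Φ.numWeights

end MNN

/-- The family `Pr ε K` of networks (two scalar inputs, written as a `1 × 2` matrix, and one scalar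
output) approximates the product on `[-K, K]²` up to `ε`, for all `ε, K > 0`. -/
def ApproximatesProduct {ϱ : ℝ → ℝ} (Pr : ℝ → ℝ → MNN ϱ 1 2 1 1) : Prop :=
  ∀ ε K : ℝ, 0 < ε → 0 < K → ∀ x ∈ Set.Icc (-K) K, ∀ y ∈ Set.Icc (-K) K,
    |x * y - (Pr ε K).realize !![x, y] 0 0| ≤ ε

/-- `N(ε, δ) = max {⌈log₂ (log₂ (ε (1 - δ)) / log₂ δ)⌉, 1}`. When `ε (1 - δ) ≥ 1` the argument of
the outer logarithm is nonpositive; this logarithm then counts as `-∞`, so that the value is `1`. -/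
noncomputable def neumannLevel (ε δ : ℝ) : ℕ :=
  if ε * (1 - δ) < 1 then
    max ⌈Real.logb 2 (Real.logb 2 (ε * (1 - δ)) / Real.logb 2 δ)⌉₊ 1
  else 1

/-- `Σ(ε, δ, n) = 2 ^ (-2 ^ N(ε, δ)) * min {ε, 1/4} / (16 n³)`. -/
noncomputable def productAccuracy (ε δ : ℝ) (n : ℕ) : ℝ :=
  ((2 : ℝ) ^ (2 ^ neumannLevel ε δ))⁻¹ * (min ε (1 / 4) / (16 * (n : ℝ) ^ 3))

/-! Put `B = 1 - αA` and `η = ε/|α|`. Then `A⁻¹ = α ∑ B^k`, and the first `2^N` terms factor as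
`∏_{j<N} (1 + B^(2^j))`. This takes `N - 1` squarings and `N - 1` further products. Each product is
computed by Strassen's algorithm with the scalar network at the leaves (`MNN.exists_mul_chain`),
after padding to size `2^⌈log₂ n⌉ ≤ 2n`.

The choice of `N` makes the truncation error at most `η/2` (`norm_inverse_sub_scaledNeumann_le`,
`pow_neumannLevel_le`). To control the errors of the products every factor is halved: all exact and
computed intermediate matrices then have norm at most 1, the scalar network is never used outside
its range, and errors grow only like `2^j` (`NeumannApprox.succ`). The last layer restores the
factor `α 2^N`, and the accuracy of the products keeps the resulting error below `η/2`
(`final_error_le`).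

The accuracy is defined through the level of `η`, but `N` is the level of `η/2`. The two differ by
at most one if `η(1 - δ) < 1/2` (`neumannLevel_half_le`), and may be far apart otherwise. If `N ≥ 2`
and `η(1 - δ) ≥ 1/2`, the tolerance is so large that a constant network suffices
(`exists_mnn_const_inverse`). If `N = 1`, two terms are affine in `A` and need no product. -/

/-! ### Affine layers, their compositions, and the count of weights -/

open Classical in
/-- The indicator of being nonzero. -/
noncomputable def nz (a : ℝ) : ℕ := if a = 0 then 0 else 1

@[simp] lemma nz_zero : nz 0 = 0 := by simp [nz]

lemma nz_of_ne {a : ℝ} (h : a ≠ 0) : nz a = 1 := by simp [nz, h]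

@[simp] lemma nz_one : nz 1 = 1 := nz_of_ne one_ne_zero

@[simp] lemma nz_neg_one : nz (-1) = 1 := nz_of_ne (by norm_num)

lemma nz_le_one (a : ℝ) : nz a ≤ 1 := by
  unfold nz; split <;> simp

lemma nz_ite_zero (p : Prop) [Decidable p] (a : ℝ) :
    nz (if p then a else 0) = if p then nz a else 0 := by
  split <;> simp

/-- The number of nonzero weights of an affine layer. -/
noncomputable def layerWeights {ι κ : Type} [Fintype ι] [Fintype κ] (T : κ → ι → ℝ) (C : κ → ℝ) :
    ℕ :=
  ∑ k, ((∑ i, nz (T k i)) + nz (C k))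

/-- `f` is an affine map with at most `w` nonzero weights, followed entrywise by `id` or `ϱ`. -/
def IsLayer (ϱ : ℝ → ℝ) {ι κ : Type} [Fintype ι] [Fintype κ] (w : ℕ) (f : (ι → ℝ) → κ → ℝ) :
    Prop :=
  ∃ (T : κ → ι → ℝ) (C : κ → ℝ) (act : κ → ℝ → ℝ), (∀ k, act k = id ∨ act k = ϱ) ∧
    layerWeights T C ≤ w ∧ ∀ x k, f x k = act k (∑ i, T k i * x i + C k)

namespace IsLayer

variable {ϱ : ℝ → ℝ} {ι κ ι' κ' : Type} [Fintype ι] [Fintype κ] [Fintype ι'] [Fintype κ']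
  {w w' : ℕ} {f : (ι → ℝ) → κ → ℝ} {g : (ι' → ℝ) → κ' → ℝ}

lemma of_affine (T : κ → ι → ℝ) (C : κ → ℝ) (hw : layerWeights T C ≤ w)
    (hf : ∀ x k, f x k = ∑ i, T k i * x i + C k) : IsLayer ϱ w f :=
  ⟨T, C, fun _ => id, fun _ => Or.inl rfl, hw, hf⟩

/-- Idle data must be carried through layers at a cost of one weight per entry; the identity
activation permits this for every `ϱ`. -/
lemma identity : IsLayer ϱ (Fintype.card ι) (fun x : ι → ℝ => x) := by
  classical
  refine of_affine (fun k i => if k = i then 1 else 0) 0 ?_ ?_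
  · simp [layerWeights, nz_ite_zero]
  · intro x k
    simp

/-- Independent copies of a layer. -/
lemma copies (J : Type) [Fintype J] (hf : IsLayer ϱ w f) :
    IsLayer ϱ (Fintype.card J * w)
      (fun (x : J × ι → ℝ) (p : J × κ) => f (fun i => x (p.1, i)) p.2) := by
  classical
  obtain ⟨T, C, act, hact, hw, hf⟩ := hf
  refine ⟨fun p q => if p.1 = q.1 then T p.2 q.2 else 0, fun p => C p.2, fun p => act p.2,
    fun p => hact p.2, ?_, ?_⟩
  · simp only [layerWeights, nz_ite_zero, Fintype.sum_prod_type]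
    have : ∀ x : J, ∀ y : κ, ∑ x' : J, ∑ i : ι, (if x = x' then nz (T y i) else 0)
        = ∑ i, nz (T y i) := by
      intro x y
      rw [Finset.sum_comm]
      simp
    simp only [this, Finset.sum_const, Finset.card_univ, smul_eq_mul]
    exact Nat.mul_le_mul_left _ hw
  · rintro x ⟨j, k⟩
    refine (hf _ _).trans ?_
    congr 2
    rw [Fintype.sum_prod_type, Finset.sum_comm]
    simp [ite_mul]

/-- Two layers in parallel. -/
lemma par (hf : IsLayer ϱ w f) (hg : IsLayer ϱ w' g) :
    IsLayer ϱ (w + w') (fun x : ι ⊕ ι' → ℝ =>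
      Sum.elim (f (fun i => x (Sum.inl i))) (g (fun i => x (Sum.inr i)))) := by
  obtain ⟨T, C, act, hact, hw, hf⟩ := hf
  obtain ⟨T', C', act', hact', hw', hg⟩ := hg
  refine ⟨Sum.elim (fun k => Sum.elim (T k) 0) (fun k => Sum.elim 0 (T' k)), Sum.elim C C',
    Sum.elim act act', ?_, ?_, ?_⟩
  · rintro (k | k)
    · exact hact k
    · exact hact' k
  · simp only [layerWeights, Fintype.sum_sum_type, Sum.elim_inl, Sum.elim_inr, Pi.zero_apply,
      nz_zero, Finset.sum_const_zero, add_zero, zero_add]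
    exact add_le_add hw hw'
  · rintro x (k | k)
    · simp [hf]
    · simp [hg]

/-- Restricting the input of a layer to some entries, the others being zero. -/
lemma extend_input (hf : IsLayer ϱ w f) (u : ι' → ι) (hu : Function.Injective u) :
    IsLayer ϱ w (fun x : ι' → ℝ => f (Function.extend u x 0)) := by
  obtain ⟨T, C, act, hact, hw, hf⟩ := hf
  refine ⟨fun k i => T k (u i), C, act, hact, le_trans ?_ hw, ?_⟩
  · refine Finset.sum_le_sum fun k _ => Nat.add_le_add_right ?_ _
    classical
    rw [← Finset.sum_image (s := Finset.univ) (g := u) (f := fun i => nz (T k i))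
      (fun a _ b _ h => hu h)]
    exact Finset.sum_le_sum_of_subset (Finset.subset_univ _)
  · intro x k
    refine (hf _ _).trans ?_
    congr 2
    symm
    apply Fintype.sum_of_injective u hu
    · intro i hi
      rw [Function.extend_apply' _ _ _ (by simpa using hi)]
      simp
    · intro i
      rw [hu.extend_apply]

/-- Keeping only some entries of the output of a layer. -/
lemma select_output (hf : IsLayer ϱ w f) (v : κ' → κ) (hv : Function.Injective v) :
    IsLayer ϱ w (fun x k => f x (v k)) := by
  obtain ⟨T, C, act, hact, hw, hf⟩ := hf
  refine ⟨fun k => T (v k), fun k => C (v k), fun k => act (v k), fun k => hact _,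
    le_trans ?_ hw, fun x k => hf x _⟩
  classical
  unfold layerWeights
  rw [← Finset.sum_image (s := Finset.univ) (g := v)
    (f := fun k => ((∑ i, nz (T k i)) + nz (C k))) (fun a _ b _ h => hv h)]
  exact Finset.sum_le_sum_of_subset (Finset.subset_univ _)

end IsLayer

/-- `f` is a composition of `L` layers with at most `W` nonzero weights in total. -/
inductive Chain (ϱ : ℝ → ℝ) : {ι κ : Type} → ℕ → ℕ → ((ι → ℝ) → κ → ℝ) → Prop
  | nil {ι : Type} : Chain ϱ 0 0 (fun x : ι → ℝ => x)
  | cons {ι κ μ : Type} [Fintype ι] [Fintype κ] {L W w : ℕ} {f : (ι → ℝ) → κ → ℝ}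
      {g : (κ → ℝ) → μ → ℝ} (hf : IsLayer ϱ w f) (hg : Chain ϱ L W g) :
      Chain ϱ (L + 1) (w + W) (fun x => g (f x))

namespace Chain

variable {ϱ : ℝ → ℝ} {ι κ μ ι' κ' : Type} {L L' W W' : ℕ}

lemma of_layer [Fintype ι] [Fintype κ] {f : (ι → ℝ) → κ → ℝ} (hf : IsLayer ϱ W f) :
    Chain ϱ 1 W f :=
  cons hf nil

lemma cast {f : (ι → ℝ) → κ → ℝ} (hf : Chain ϱ L W f) (hL : L = L') (hW : W = W') :
    Chain ϱ L' W' f := by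
  subst hL hW
  exact hf

/-- Layers are concatenated, not merged, because an activation may stand between them; so layers and
weights both add up exactly. -/
lemma comp {f : (ι → ℝ) → κ → ℝ} {g : (κ → ℝ) → μ → ℝ} (hg : Chain ϱ L' W' g)
    (hf : Chain ϱ L W f) : Chain ϱ (L + L') (W + W') (fun x => g (f x)) := by
  induction hf with
  | nil => simpa using hg
  | cons h _ ih =>
    have := cons h (ih hg)
    rw [Nat.add_right_comm, Nat.add_assoc _ _ W']
    exact this

lemma identity [Fintype ι] (L : ℕ) :
    Chain ϱ L (L * Fintype.card ι) (fun x : ι → ℝ => x) := by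
  induction L with
  | zero => simpa using nil
  | succ L ih =>
    rw [Nat.succ_mul, Nat.add_comm (L * _)]
    exact cons IsLayer.identity ih

lemma copies (J : Type) [Fintype J] {f : (ι → ℝ) → κ → ℝ} (hf : Chain ϱ L W f) :
    Chain ϱ L (Fintype.card J * W)
      (fun (x : J × ι → ℝ) (p : J × κ) => f (fun i => x (p.1, i)) p.2) := by
  induction hf with
  | nil => exact nil
  | cons h _ ih =>
    rw [Nat.mul_add]
    exact cons (h.copies J) ih

lemma par {f : (ι → ℝ) → κ → ℝ} {g : (ι' → ℝ) → κ' → ℝ} (hf : Chain ϱ L W f)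
    (hg : Chain ϱ L W' g) :
    Chain ϱ L (W + W') (fun x : ι ⊕ ι' → ℝ =>
      Sum.elim (f (fun i => x (Sum.inl i))) (g (fun i => x (Sum.inr i)))) := by
  induction hf generalizing ι' W' with
  | nil =>
    cases hg
    convert nil (ϱ := ϱ) using 1
    funext x i
    cases i <;> rfl
  | cons h _ ih =>
    cases hg with
    | cons h' hg' =>
      have := cons (h.par h') (ih hg')
      rw [add_add_add_comm]
      exact this

lemma extend_input [Fintype ι'] {f : (ι → ℝ) → κ → ℝ} (hf : Chain ϱ L W f)
    (hL : 0 < L) (u : ι' → ι) (hu : Function.Injective u) :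
    Chain ϱ L W (fun x : ι' → ℝ => f (Function.extend u x 0)) := by
  cases hf with
  | nil => exact absurd hL (lt_irrefl 0)
  | cons h hg =>
    exact cons (h.extend_input u hu) hg

lemma select_output [Fintype κ'] {f : (ι → ℝ) → κ → ℝ} (hf : Chain ϱ L W f)
    (hL : 0 < L) (v : κ' → κ) (hv : Function.Injective v) :
    Chain ϱ L W (fun x k => f x (v k)) := by
  induction hf with
  | nil => exact absurd hL (lt_irrefl 0)
  | @cons _ _ _ _ _ L' _ _ _ _ h hg ih =>
    rcases Nat.eq_zero_or_pos L' with rfl | h'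
    · cases hg
      exact cons (h.select_output v hv) nil
    · exact cons h (ih h' v hv)

end Chain

/-! ### Passage between chains and matrix neural networks -/

lemma matNumNonzero_eq_sum {r c : ℕ} (C : Matrix (Fin r) (Fin c) ℝ) :
    matNumNonzero C = ∑ p : Fin r × Fin c, nz (C p.1 p.2) := by
  classical
  simp only [matNumNonzero, Set.ncard_eq_toFinset_card', Set.toFinset_ofPred, Finset.card_filter, nz]
  exact Finset.sum_congr rfl fun p _ => by by_cases h : C p.1 p.2 = 0 <;> simp [h]

lemma MatTensor.numNonzero_eq_sum {r c r₀ c₀ : ℕ} (T : MatTensor r c r₀ c₀) :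
    T.numNonzero = ∑ p : Fin r × Fin c, ∑ q : Fin r₀ × Fin c₀, nz (T p.1 p.2 q.1 q.2) := by
  classical
  simp only [MatTensor.numNonzero, Set.ncard_eq_toFinset_card', Set.toFinset_ofPred,
    Finset.card_filter, nz]
  simp only [Fintype.sum_prod_type]
  refine Finset.sum_congr rfl fun i _ => Finset.sum_congr rfl fun j _ => ?_
  refine Finset.sum_congr rfl fun k _ => Finset.sum_congr rfl fun l _ => ?_
  by_cases h : T i j k l = 0 <;> simp [h]

lemma layerWeights_eq {r c r₀ c₀ : ℕ} (T : MatTensor r c r₀ c₀) (C : Matrix (Fin r) (Fin c) ℝ) :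
    layerWeights (fun (p : Fin r × Fin c) (q : Fin r₀ × Fin c₀) => T p.1 p.2 q.1 q.2)
      (fun p => C p.1 p.2) = T.numNonzero + matNumNonzero C := by
  rw [layerWeights, Finset.sum_add_distrib, T.numNonzero_eq_sum, matNumNonzero_eq_sum]

lemma MatTensor.apply_eq_sum {r c r₀ c₀ : ℕ} (T : MatTensor r c r₀ c₀)
    (A : Matrix (Fin r₀) (Fin c₀) ℝ) (i : Fin r) (j : Fin c) :
    T.apply A i j = ∑ q : Fin r₀ × Fin c₀, T i j q.1 q.2 * A q.1 q.2 := by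
  rw [Fintype.sum_prod_type, Finset.sum_comm]
  rfl

/-- A matrix neural network is a chain of layers. -/
lemma MNN.chain {ϱ : ℝ → ℝ} {r₀ c₀ r c : ℕ} (Φ : MNN ϱ r₀ c₀ r c) :
    Chain ϱ Φ.numLayers Φ.numWeights (fun (x : Fin r₀ × Fin c₀ → ℝ) (p : Fin r × Fin c) =>
      Φ.realize (Matrix.of fun i j => x (i, j)) p.1 p.2) := by
  induction Φ with
  | last T C =>
    refine Chain.of_layer (IsLayer.of_affine _ _ (layerWeights_eq T C).le fun x p => ?_)
    rw [MNN.realize, Matrix.add_apply, T.apply_eq_sum]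
    rfl
  | cons T C act hact Φ ih =>
    rw [MNN.numLayers, MNN.numWeights]
    exact Chain.cons (f := fun x p => act p.1 p.2 ((T.apply (Matrix.of fun i j => x (i, j)) + C) p.1 p.2))
      ⟨_, _, fun p => act p.1 p.2, fun p => hact p.1 p.2, (layerWeights_eq T C).le, fun x p =>
        congrArg (act p.1 p.2) (by rw [Matrix.add_apply, T.apply_eq_sum]; rfl)⟩ ih

lemma MNN.numLayers_pos {ϱ : ℝ → ℝ} {r₀ c₀ r c : ℕ} (Φ : MNN ϱ r₀ c₀ r c) : 0 < Φ.numLayers := by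
  cases Φ <;> simp [MNN.numLayers]

lemma layerWeights_reindex {ι κ ι' κ' : Type} [Fintype ι] [Fintype κ] [Fintype ι'] [Fintype κ']
    (T : κ → ι → ℝ) (C : κ → ℝ) (e : ι' ≃ ι) (e' : κ' ≃ κ) :
    layerWeights (fun k i => T (e' k) (e i)) (fun k => C (e' k)) = layerWeights T C := by
  unfold layerWeights
  rw [← Equiv.sum_comp e']
  refine Finset.sum_congr rfl fun k _ => ?_
  rw [← Equiv.sum_comp e]

/-- A chain of layers followed by an affine map is the realization of a matrix neural network. -/
lemma Chain.exists_mnn {ϱ : ℝ → ℝ} {ι κ : Type} [hκ : Fintype κ] {L W : ℕ}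
    {f : (ι → ℝ) → κ → ℝ} (hf : Chain ϱ L W f) {r c r₀ c₀ : ℕ} (e : Fin r₀ × Fin c₀ ≃ ι)
    (T : Fin r × Fin c → κ → ℝ) (C : Fin r × Fin c → ℝ) :
    ∃ Φ : MNN ϱ r₀ c₀ r c, Φ.numLayers = L + 1 ∧ Φ.numWeights ≤ W + layerWeights T C ∧
      ∀ A i j, Φ.realize A i j
        = ∑ k, T (i, j) k * f (fun q => A (e.symm q).1 (e.symm q).2) k + C (i, j) := by
  induction hf generalizing r₀ c₀ hκ with
  | nil =>
    refine ⟨MNN.last (fun i j k l => T (i, j) (e (k, l))) (Matrix.of fun i j => C (i, j)), rfl,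
      ?_, ?_⟩
    · rw [MNN.numWeights, ← layerWeights_eq, zero_add]
      exact (layerWeights_reindex T C e (Equiv.refl _)).le
    · intro A i j
      rw [MNN.realize, Matrix.add_apply, MatTensor.apply_eq_sum, ← Equiv.sum_comp e]
      simp
  | @cons ι κ' μ inst _ L W w f g h hg ih =>
    obtain ⟨T₀, C₀, act, hact, hw, hf⟩ := h
    -- Hidden layers are laid out as a single column, so that arbitrary finite index types are
    -- allowed inside a chain.
    let e' : Fin (Fintype.card κ') × Fin 1 ≃ κ' := (Equiv.prodUnique _ _).trans
      (Fintype.equivFin κ').symm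
    obtain ⟨Φ, hL, hW, hΦ⟩ := ih e' T
    refine ⟨MNN.cons (fun i j k l => T₀ (e' (i, j)) (e (k, l))) (Matrix.of fun i j => C₀ (e' (i, j)))
      (fun i j => act (e' (i, j))) (fun i j => hact _) Φ, by rw [MNN.numLayers, hL], ?_, ?_⟩
    · rw [MNN.numWeights, ← layerWeights_eq, add_assoc]
      refine add_le_add (le_trans (le_of_eq ?_) hw) hW
      rw [← layerWeights_reindex T₀ C₀ e e']
      congr!
    · intro A i j
      rw [MNN.realize, hΦ]
      congr! with k _ q
      rw [hf, Matrix.of_apply, Matrix.add_apply, MatTensor.apply_eq_sum, ← Equiv.sum_comp e]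
      simp

/-! ### Strassen multiplication -/

/-- The combinations of the blocks of the left factor in Strassen's algorithm. -/
noncomputable def strassenLeft : Fin 7 → Fin 2 → Fin 2 → ℝ :=
  ![![![1, 0], ![0, 1]], ![![0, 0], ![1, 1]], ![![1, 0], ![0, 0]], ![![0, 0], ![0, 1]],
    ![![1, 1], ![0, 0]], ![![-1, 0], ![1, 0]], ![![0, 1], ![0, -1]]]

/-- The combinations of the blocks of the right factor in Strassen's algorithm. -/
noncomputable def strassenRight : Fin 7 → Fin 2 → Fin 2 → ℝ :=
  ![![![1, 0], ![0, 1]], ![![1, 0], ![0, 0]], ![![0, 1], ![0, -1]], ![![-1, 0], ![1, 0]],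
    ![![0, 0], ![0, 1]], ![![1, 1], ![0, 0]], ![![0, 0], ![1, 1]]]

/-- The combinations of the seven products that give the blocks of the product in Strassen's
algorithm. -/
noncomputable def strassenOut : Fin 2 → Fin 2 → Fin 7 → ℝ :=
  ![![![1, 0, 0, 1, -1, 0, 1], ![0, 0, 1, 0, 1, 0, 0]],
    ![![0, 1, 0, 1, 0, 0, 0], ![1, -1, 1, 0, 0, 1, 0]]]

/-- The seven pairs of factors formed in one step of Strassen's algorithm. -/
noncomputable def strassenPre {I : Type}
    (x : ((Fin 2 × I) × (Fin 2 × I)) ⊕ ((Fin 2 × I) × (Fin 2 × I)) → ℝ) :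
    Fin 7 × ((I × I) ⊕ (I × I)) → ℝ
  | (p, Sum.inl (i, j)) => ∑ a, ∑ b, strassenLeft p a b * x (Sum.inl ((a, i), (b, j)))
  | (p, Sum.inr (i, j)) => ∑ a, ∑ b, strassenRight p a b * x (Sum.inr ((a, i), (b, j)))

/-- The recombination of the seven products in one step of Strassen's algorithm. -/
noncomputable def strassenPost {I : Type} (x : Fin 7 × (I × I) → ℝ) :
    (Fin 2 × I) × (Fin 2 × I) → ℝ
  | ((a, i), (b, j)) => ∑ p, strassenOut a b p * x (p, (i, j))

lemma isLayer_strassenPre (ϱ : ℝ → ℝ) (I : Type) [Fintype I] :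
    IsLayer ϱ (24 * Fintype.card I ^ 2) (strassenPre (I := I)) := by
  classical
  refine IsLayer.of_affine (fun k q => match k, q with
    | (p, Sum.inl (i, j)), Sum.inl ((a, i'), (b, j')) =>
      if i = i' then if j = j' then strassenLeft p a b else 0 else 0
    | (p, Sum.inr (i, j)), Sum.inr ((a, i'), (b, j')) =>
      if i = i' then if j = j' then strassenRight p a b else 0 else 0
    | _, _ => 0) 0 (le_of_eq ?_) ?_
  · simp only [layerWeights, Fintype.sum_sum_type, Fintype.sum_prod_type, nz_ite_zero, nz_zero,
      Pi.zero_apply, Finset.sum_ite_eq, Finset.sum_const_zero, Finset.mem_univ, if_true, add_zero,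
      zero_add, Finset.sum_const, Finset.card_univ, smul_eq_mul, Finset.sum_ite_irrel]
    simp [Fin.sum_univ_succ, strassenLeft, strassenRight]
    ring
  · rintro x ⟨p, ⟨i, j⟩ | ⟨i, j⟩⟩ <;>
    simp only [strassenPre, Fintype.sum_sum_type, Fintype.sum_prod_type, Pi.zero_apply, ite_mul,
      zero_mul, Finset.sum_ite_eq, Finset.sum_const_zero, Finset.mem_univ, if_true, add_zero,
      zero_add, Finset.sum_ite_irrel]

lemma isLayer_strassenPost (ϱ : ℝ → ℝ) (I : Type) [Fintype I] :
    IsLayer ϱ (12 * Fintype.card I ^ 2) (strassenPost (I := I)) := by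
  classical
  refine IsLayer.of_affine (fun k q => match k, q with
    | ((a, i), (b, j)), (p, (i', j')) =>
      if i = i' then if j = j' then strassenOut a b p else 0 else 0) 0 (le_of_eq ?_) ?_
  · simp only [layerWeights, Fintype.sum_prod_type, nz_ite_zero, nz_zero,
      Pi.zero_apply, Finset.sum_ite_eq, Finset.sum_const_zero, Finset.mem_univ, if_true, add_zero,
      Finset.sum_const, Finset.card_univ, smul_eq_mul, Finset.sum_ite_irrel]
    simp [Fin.sum_univ_succ, strassenOut]
    ring
  · rintro x ⟨⟨a, i⟩, ⟨b, j⟩⟩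
    simp only [strassenPost, Fintype.sum_prod_type, Pi.zero_apply, ite_mul,
      zero_mul, Finset.sum_ite_eq, Finset.sum_const_zero, Finset.mem_univ, if_true, add_zero,
      Finset.sum_ite_irrel]

/-- `f` approximates the product of two square matrices with entries bounded by `K`, with an error
of at most `σ` in every entry. -/
def ApproxMul {I : Type} [Fintype I] (K σ : ℝ) (f : ((I × I) ⊕ (I × I) → ℝ) → I × I → ℝ) : Prop :=
  ∀ x, (∀ p, |x p| ≤ K) →
    ∀ i j, |f x (i, j) - ∑ l, x (Sum.inl (i, l)) * x (Sum.inr (l, j))| ≤ σ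

lemma strassen_identity {I : Type} [Fintype I]
    (x : ((Fin 2 × I) × (Fin 2 × I)) ⊕ ((Fin 2 × I) × (Fin 2 × I)) → ℝ) (i j : Fin 2 × I) :
    strassenPost (fun q => ∑ l, strassenPre x (q.1, Sum.inl (q.2.1, l)) *
      strassenPre x (q.1, Sum.inr (l, q.2.2))) (i, j)
      = ∑ l, x (Sum.inl (i, l)) * x (Sum.inr (l, j)) := by
  obtain ⟨a, i⟩ := i
  obtain ⟨b, j⟩ := j
  simp only [strassenPost, strassenPre, Fintype.sum_prod_type, Finset.mul_sum (s := Finset.univ (α := I))]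
  rw [Finset.sum_comm, Finset.sum_comm (s := Finset.univ (α := Fin 2))]
  refine Finset.sum_congr rfl fun l _ => ?_
  fin_cases a <;> fin_cases b <;>
    simp [Fin.sum_univ_succ, strassenLeft, strassenRight, strassenOut] <;> ring

lemma abs_sum_mul_le {ι : Type} [Fintype ι] (c x : ι → ℝ) {a s : ℝ} (ha : 0 ≤ a) (hx : ∀ i, |x i| ≤ a)
    (hc : ∑ i, |c i| ≤ s) : |∑ i, c i * x i| ≤ s * a := by
  calc |∑ i, c i * x i| ≤ ∑ i, |c i| * a := by
        refine (Finset.abs_sum_le_sum_abs _ _).trans (Finset.sum_le_sum fun i _ => ?_)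
        rw [abs_mul]
        exact mul_le_mul_of_nonneg_left (hx i) (abs_nonneg _)
    _ ≤ s * a := by
        rw [← Finset.sum_mul]
        exact mul_le_mul_of_nonneg_right hc ha

/-- Each factor formed is a combination of at most two blocks with signs, so entries at most double;
each output block combines at most four products with signs, so errors at most quadruple. -/
lemma ApproxMul.strassen_step {I : Type} [Fintype I] {K σ : ℝ} (hK : 0 ≤ K) (hσ : 0 ≤ σ)
    {f : ((I × I) ⊕ (I × I) → ℝ) → I × I → ℝ} (hf : ApproxMul (2 * K) σ f) :
    ApproxMul K (4 * σ) (fun x => strassenPost (fun q : Fin 7 × (I × I) =>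
      f (fun r => strassenPre x (q.1, r)) q.2)) := by
  intro x hx i j
  have hpre : ∀ p r, |strassenPre x (p, r)| ≤ 2 * K := by
    rintro p (⟨i, j⟩ | ⟨i, j⟩)
    · simp only [strassenPre, ← Fintype.sum_prod_type']
      refine abs_sum_mul_le (fun s : Fin 2 × Fin 2 => strassenLeft p s.1 s.2) _ hK (fun _ => hx _) ?_
      rw [Fintype.sum_prod_type]
      fin_cases p <;> simp [strassenLeft] <;> norm_num
    · simp only [strassenPre, ← Fintype.sum_prod_type']
      refine abs_sum_mul_le (fun s : Fin 2 × Fin 2 => strassenRight p s.1 s.2) _ hK (fun _ => hx _) ?_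
      rw [Fintype.sum_prod_type]
      fin_cases p <;> simp [strassenRight] <;> norm_num
  rw [← strassen_identity]
  obtain ⟨a, i⟩ := i
  obtain ⟨b, j⟩ := j
  simp only [strassenPost]
  rw [← Finset.sum_sub_distrib]
  simp only [← mul_sub]
  refine abs_sum_mul_le _ _ hσ (fun p => hf _ (fun r => hpre p r) i j) ?_
  fin_cases a <;> fin_cases b <;> simp [strassenOut, Fin.sum_univ_succ] <;> norm_num

/-- Strassen's algorithm as a chain of layers. -/
lemma exists_strassen_chain {ϱ : ℝ → ℝ} {L M : ℕ} {K σ : ℝ} (hK : 0 ≤ K) (hσ : 0 ≤ σ)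
    {f : ((Unit × Unit) ⊕ (Unit × Unit) → ℝ) → Unit × Unit → ℝ} (hc : Chain ϱ L M f)
    (hf : ApproxMul K σ f) (k : ℕ) :
    ∃ (I : Type) (_ : Fintype I), Fintype.card I = 2 ^ k ∧
      ∃ (W : ℕ) (g : ((I × I) ⊕ (I × I) → ℝ) → I × I → ℝ), Chain ϱ (2 * k + L) W g ∧
        W + 12 * 4 ^ k = 7 ^ k * (M + 12) ∧ ApproxMul (K / 2 ^ k) (4 ^ k * σ) g := by
  induction k with
  | zero => exact ⟨Unit, inferInstance, rfl, M, f, by simpa using hc, by ring, by simpa using hf⟩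
  | succ k ih =>
    obtain ⟨I, _, hI, W, g, hg, hW, hgK⟩ := ih
    -- The recursion `W' = 7 W + (24 + 12) 4^k` has the particular solution `-12 · 4^k`, hence the
    -- invariant `W + 12 · 4^k = 7^k (M + 12)`.
    refine ⟨Fin 2 × I, inferInstance, by simp [hI, pow_succ, mul_comm],
      36 * 4 ^ k + 7 * W, fun x => strassenPost (fun q : Fin 7 × (I × I) =>
        g (fun r => strassenPre x (q.1, r)) q.2), ?_, ?_, ?_⟩
    rotate_left 2
    · rw [pow_succ 4, mul_comm _ (4 : ℝ), mul_assoc]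
      refine ApproxMul.strassen_step (by positivity) (by positivity) (f := g) ?_
      rwa [show 2 * (K / 2 ^ (k + 1)) = K / 2 ^ k by field_simp; ring]
    · have h := ((Chain.of_layer (isLayer_strassenPost ϱ I)).comp (hg.copies (Fin 7))).comp
        (Chain.of_layer (isLayer_strassenPre ϱ I))
      have e : Fintype.card I ^ 2 = 4 ^ k := by
        rw [hI, ← pow_mul, mul_comm, pow_mul]
        norm_num
      rw [e, Fintype.card_fin] at h
      convert h using 1 <;> ring
    · rw [pow_succ 7, mul_right_comm, ← hW]
      ring

lemma ApproxMul.mono {I : Type} [Fintype I] {K K' σ σ' : ℝ}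
    {f : ((I × I) ⊕ (I × I) → ℝ) → I × I → ℝ} (hf : ApproxMul K σ f) (hK : K' ≤ K) (hσ : σ ≤ σ') :
    ApproxMul K' σ' f :=
  fun x hx i j => (hf x (fun p => (hx p).trans hK) i j).trans hσ

/-- Padding with zeros: the additional indices contribute nothing to the inner sums, and zero
entries respect the bound `K`. -/
lemma ApproxMul.restrict {I J : Type} [Fintype I] [Fintype J] {K σ : ℝ} (hK : 0 ≤ K)
    {f : ((I × I) ⊕ (I × I) → ℝ) → I × I → ℝ} (hf : ApproxMul K σ f) (u : J → I)
    (hu : Function.Injective u) :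
    ApproxMul K σ (fun x p => f (Function.extend (Sum.map (Prod.map u u) (Prod.map u u)) x 0)
      (Prod.map u u p)) := by
  have hu2 := hu.prodMap hu
  have hu' := hu2.sumMap hu2
  intro x hx i j
  have hK' : ∀ p, |Function.extend (Sum.map (Prod.map u u) (Prod.map u u)) x 0 p| ≤ K := by
    intro p
    by_cases h : ∃ q, Sum.map (Prod.map u u) (Prod.map u u) q = p
    · obtain ⟨q, rfl⟩ := h
      rw [hu'.extend_apply]
      exact hx q
    · rw [Function.extend_apply' _ _ _ h]
      simpa using hK
  refine le_of_eq_of_le ?_ (hf _ hK' (u i) (u j))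
  congr 2
  apply Fintype.sum_of_injective u hu
  · intro l hl
    rw [Function.extend_apply', Pi.zero_apply, zero_mul]
    rintro ⟨⟨a, b⟩ | ⟨a, b⟩, h⟩ <;> simp at h
    exact hl ⟨b, h.2⟩
  · intro l
    rw [← hu'.extend_apply x 0 (Sum.inl (i, l)), ← hu'.extend_apply x 0 (Sum.inr (l, j))]
    rfl

lemma MNN.exists_scalar_mul_chain {ϱ : ℝ → ℝ} (Φ : MNN ϱ 1 2 1 1) {K σ : ℝ}
    (hΦ : ∀ x ∈ Set.Icc (-K) K, ∀ y ∈ Set.Icc (-K) K, |x * y - Φ.realize !![x, y] 0 0| ≤ σ) :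
    ∃ f : ((Unit × Unit) ⊕ (Unit × Unit) → ℝ) → Unit × Unit → ℝ,
      Chain ϱ Φ.numLayers Φ.numWeights f ∧ ApproxMul K σ f := by
  let u : (Unit × Unit) ⊕ (Unit × Unit) → Fin 1 × Fin 2 := Sum.elim (fun _ => (0, 0)) (fun _ => (0, 1))
  have hu : Function.Injective u := by
    rintro (a | a) (b | b) h <;> simp [u, Prod.ext_iff] at h ⊢
  have hc := (Φ.chain.extend_input Φ.numLayers_pos u hu).select_output Φ.numLayers_pos
    (fun _ : Unit × Unit => ((0, 0) : Fin 1 × Fin 1)) (fun _ _ _ => Subsingleton.elim _ _)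
  refine ⟨_, hc, fun x hx i j => ?_⟩
  rw [abs_sub_comm]
  have e : (Matrix.of fun i j => Function.extend u x 0 (i, j))
      = !![x (Sum.inl ((), ())), x (Sum.inr ((), ()))] := by
    ext a b
    fin_cases a
    fin_cases b
    · exact hu.extend_apply x 0 (Sum.inl ((), ()))
    · exact hu.extend_apply x 0 (Sum.inr ((), ()))
  simp only [e]
  simpa using hΦ _ (abs_le.1 (hx (Sum.inl ((), ())))) _ (abs_le.1 (hx (Sum.inr ((), ()))))

/-- A network for the product of two `n × n` matrices, from one for the product of two numbers. -/
lemma MNN.exists_mul_chain {ϱ : ℝ → ℝ} (Φ : MNN ϱ 1 2 1 1) {K σ : ℝ} (hK : 0 ≤ K) (hσ : 0 ≤ σ)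
    (hΦ : ∀ x ∈ Set.Icc (-K) K, ∀ y ∈ Set.Icc (-K) K, |x * y - Φ.realize !![x, y] 0 0| ≤ σ)
    {n k : ℕ} (hn : n ≤ 2 ^ k) :
    ∃ (W : ℕ) (g : ((Fin n × Fin n) ⊕ (Fin n × Fin n) → ℝ) → Fin n × Fin n → ℝ),
      Chain ϱ (2 * k + Φ.numLayers) W g ∧ W + 12 * 4 ^ k = 7 ^ k * (Φ.numWeights + 12) ∧
        ApproxMul (K / 2 ^ k) (4 ^ k * σ) g := by
  obtain ⟨f, hc, hf⟩ := Φ.exists_scalar_mul_chain hΦ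
  obtain ⟨I, _, hI, W, g, hg, hW, hgK⟩ := exists_strassen_chain hK hσ hc hf k
  obtain ⟨u⟩ : Nonempty (Fin n ↪ I) := by
    apply Function.Embedding.nonempty_of_card_le
    rwa [hI, Fintype.card_fin]
  have hu2 := u.injective.prodMap u.injective
  have hL : 0 < 2 * k + Φ.numLayers := Nat.add_pos_right _ Φ.numLayers_pos
  exact ⟨W, _, (hg.extend_input hL _ (hu2.sumMap hu2)).select_output hL _ hu2, hW,
    hgK.restrict (by positivity) u u.injective⟩

/-! ### Estimates in the operator norm -/

lemma abs_entry_le_l2_opNorm {n : ℕ} (A : Matrix (Fin n) (Fin n) ℝ) (i j : Fin n) :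
    |A i j| ≤ ‖A‖ := by
  have h := A.l2_opNorm_mulVec (EuclideanSpace.single j 1)
  rw [PiLp.norm_single, norm_one, mul_one] at h
  refine le_trans ?_ h
  refine le_trans (le_of_eq ?_) (PiLp.norm_apply_le _ i)
  simp

lemma l2_opNorm_le_of_abs_entry_le {n : ℕ} {A : Matrix (Fin n) (Fin n) ℝ} {s : ℝ} (hs : 0 ≤ s)
    (h : ∀ i j, |A i j| ≤ s) : ‖A‖ ≤ n * s := by
  rw [Matrix.cstar_norm_def]
  refine ContinuousLinearMap.opNorm_le_bound _ (by positivity) fun x => ?_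
  refine (sq_le_sq₀ (norm_nonneg _) (by positivity)).1 ?_
  rw [mul_pow, EuclideanSpace.norm_sq_eq, EuclideanSpace.norm_sq_eq]
  -- Cauchy–Schwarz in each row; summing over the rows bounds the norm by the Frobenius norm, at
  -- most `n s`.
  have key : ∀ i, ‖(Matrix.toEuclideanCLM (n := Fin n) (𝕜 := ℝ) A x) i‖ ^ 2
      ≤ n * s ^ 2 * ∑ j, ‖x j‖ ^ 2 := by
    intro i
    rw [Matrix.ofLp_toEuclideanCLM, Real.norm_eq_abs, sq_abs]
    calc (∑ j, A i j * x j) ^ 2 ≤ (∑ j, A i j ^ 2) * ∑ j, x j ^ 2 :=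
          Finset.sum_mul_sq_le_sq_mul_sq _ _ _
      _ ≤ (n * s ^ 2) * ∑ j, ‖x j‖ ^ 2 := by
          simp only [Real.norm_eq_abs, sq_abs]
          refine mul_le_mul_of_nonneg_right ?_ (Finset.sum_nonneg fun _ _ => sq_nonneg _)
          calc ∑ j, A i j ^ 2 ≤ ∑ _j : Fin n, s ^ 2 :=
                Finset.sum_le_sum fun j _ => sq_le_sq' (abs_le.1 (h i j)).1 (abs_le.1 (h i j)).2
            _ = n * s ^ 2 := by simp
  calc _ ≤ ∑ _i : Fin n, n * s ^ 2 * ∑ j, ‖x j‖ ^ 2 := Finset.sum_le_sum fun i _ => key i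
    _ = _ := by
      simp
      ring

/-- The vector form of the fact that `z ↦ (z - δ ^ 2) / (1 - z)` maps the disc `|z| ≤ δ` into
itself. -/
lemma norm_sub_sq_smul_le {V : Type*} [NormedAddCommGroup V] [InnerProductSpace ℝ V]
    {δ : ℝ} (hδ₀ : 0 ≤ δ) (hδ₁ : δ ≤ 1) (v w : V) (h : ‖w‖ ≤ δ * ‖v‖) :
    ‖w - (δ ^ 2) • v‖ ≤ δ * ‖v - w‖ := by
  refine (sq_le_sq₀ (norm_nonneg _) (by positivity)).1 ?_
  rw [mul_pow, norm_sub_sq_real, norm_sub_sq_real, inner_smul_right, norm_smul, real_inner_comm w v,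
    Real.norm_of_nonneg (sq_nonneg δ)]
  have h2 : ‖w‖ ^ 2 ≤ δ ^ 2 * ‖v‖ ^ 2 := by
    rw [← mul_pow]
    exact pow_le_pow_left₀ (norm_nonneg _) h 2
  have h3 : δ ^ 2 ≤ 1 := pow_le_one₀ hδ₀ hδ₁
  -- The inner products cancel: the right side squared minus the left side squared is `(1 -
  -- δ²)(δ²‖v‖² - ‖w‖²)`.
  nlinarith [mul_le_mul_of_nonneg_left h2 (sub_nonneg.2 h3)]

/-- The inverses of all `1 - B` with `‖B‖ ≤ δ` lie in the ball with centre `1 / (1 - δ ^ 2)` and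
radius `δ / (1 - δ ^ 2)`. -/
lemma norm_inverse_sub_smul_one_le {n : ℕ} {B S : Matrix (Fin n) (Fin n) ℝ} {δ : ℝ} (hδ₀ : 0 ≤ δ)
    (hδ₁ : δ < 1) (hB : ‖B‖ ≤ δ) (hS : (1 - B) * S = 1) :
    ‖S - (1 - δ ^ 2)⁻¹ • (1 : Matrix (Fin n) (Fin n) ℝ)‖ ≤ δ / (1 - δ ^ 2) := by
  have hd : 0 < 1 - δ ^ 2 := by nlinarith
  have e : S - (1 - δ ^ 2)⁻¹ • (1 : Matrix (Fin n) (Fin n) ℝ)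
      = (1 - δ ^ 2)⁻¹ • ((B - (δ ^ 2) • (1 : Matrix (Fin n) (Fin n) ℝ)) * S) := by
    have h1 : B * S = S - 1 := by
      rw [sub_mul, one_mul] at hS
      rw [← hS]; abel
    rw [sub_mul, h1, smul_mul_assoc, one_mul]
    have h2 : S = (1 - δ ^ 2)⁻¹ • ((1 - δ ^ 2) • S) := by
      rw [smul_smul, inv_mul_cancel₀ hd.ne', one_smul]
    nth_rw 1 [h2]
    rw [← smul_sub, sub_smul, one_smul]
    congr 1
    abel
  rw [e, norm_smul, Real.norm_of_nonneg (by positivity), div_eq_inv_mul]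
  refine mul_le_mul_of_nonneg_left ?_ (by positivity)
  rw [Matrix.cstar_norm_def]
  refine ContinuousLinearMap.opNorm_le_bound _ hδ₀ fun x => ?_
  have e1 : ∀ M : Matrix (Fin n) (Fin n) ℝ, ∀ y,
      ‖Matrix.toEuclideanCLM (n := Fin n) (𝕜 := ℝ) M y‖ ≤ ‖M‖ * ‖y‖ := fun M y => by
    rw [Matrix.cstar_norm_def]
    exact ContinuousLinearMap.le_opNorm _ _
  set T := Matrix.toEuclideanCLM (n := Fin n) (𝕜 := ℝ)
  -- With `v = S x` and `w = B S x` one has `v - w = x`, so the disc estimate bounds `(B - δ²) S x`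
  -- by `δ‖x‖`.
  have hx : x = T S x - T B (T S x) := by
    have := congrArg (fun M => T M x) hS
    simpa [map_mul, map_sub] using this.symm
  have h := norm_sub_sq_smul_le hδ₀ hδ₁.le (T S x) (T B (T S x))
    ((e1 B _).trans (mul_le_mul_of_nonneg_right hB (norm_nonneg _)))
  rw [← hx] at h
  simpa [map_mul, map_sub] using h

/-! ### Neumann sums in product form and the propagation of errors -/

section NormedRing

variable {R : Type*} [NormedRing R]

lemma norm_pow_two_pow_le {B : R} {δ : ℝ} (hδ : δ ≤ 1) (hB : ‖B‖ ≤ δ) (j : ℕ) :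
    ‖B ^ 2 ^ j‖ ≤ δ := by
  have h0 : 0 ≤ δ := (norm_nonneg _).trans hB
  refine (norm_pow_le' B (by positivity)).trans ?_
  exact (pow_le_pow_left₀ (norm_nonneg _) hB _).trans
    (pow_le_of_le_one h0 hδ (by positivity))

/-- From `S = 1 + B S`. Assuming only `‖1‖ ≤ 1` also covers the zero ring of `0 × 0` matrices. -/
lemma norm_inverse_le {B S : R} (h1 : ‖(1 : R)‖ ≤ 1) {δ : ℝ} (hδ : δ < 1) (hB : ‖B‖ ≤ δ)
    (hS : (1 - B) * S = 1) : ‖S‖ ≤ 1 / (1 - δ) := by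
  rw [le_div_iff₀ (by linarith)]
  have h2 : S = 1 + B * S := by
    rw [← hS]
    noncomm_ring
  have h3 := norm_add_le 1 (B * S)
  rw [← h2] at h3
  have h4 := norm_mul_le B S
  nlinarith [norm_nonneg S]

variable [NormedAlgebra ℝ R]

/-- The partial sum of `2 ^ j` terms of the Neumann series of `B`, divided by `2 ^ j`. -/
noncomputable def scaledNeumann (B : R) : ℕ → R
  | 0 => 1
  | j + 1 => scaledNeumann B j * ((1 / 2 : ℝ) • (1 + B ^ 2 ^ j))

lemma norm_half_smul_one_add_le (h1 : ‖(1 : R)‖ ≤ 1) {b : R} {t : ℝ} (hb : ‖b‖ ≤ t) :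
    ‖(1 / 2 : ℝ) • (1 + b)‖ ≤ (1 + t) / 2 := by
  rw [norm_smul, Real.norm_of_nonneg (by norm_num)]
  have := norm_add_le 1 b
  linarith

/-- The factor `(1 + B)/2` gives the bound and the other factors are contractions. The margin `(1 -
δ)/2` below 1 is what the accumulated errors may use up. -/
lemma norm_scaledNeumann_le (h1 : ‖(1 : R)‖ ≤ 1) {B : R} {δ : ℝ} (hδ : δ ≤ 1) (hB : ‖B‖ ≤ δ)
    {j : ℕ} (hj : 1 ≤ j) : ‖scaledNeumann B j‖ ≤ (1 + δ) / 2 := by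
  have h0 : 0 ≤ δ := (norm_nonneg _).trans hB
  induction j, hj using Nat.le_induction with
  | base => simpa [scaledNeumann] using norm_half_smul_one_add_le h1 hB
  | succ j _ ih =>
    rw [scaledNeumann]
    have h2 := norm_half_smul_one_add_le h1 (norm_pow_two_pow_le hδ hB j)
    have h3 := norm_mul_le (scaledNeumann B j) ((1 / 2 : ℝ) • (1 + B ^ 2 ^ j))
    nlinarith [norm_nonneg (scaledNeumann B j), norm_nonneg ((1 / 2 : ℝ) • (1 + B ^ 2 ^ j))]

/-- The product telescopes through `(1 - B^m)(1 + B^m) = 1 - B^(2m)`. -/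
lemma two_pow_smul_scaledNeumann_mul (B : R) (j : ℕ) :
    ((2 : ℝ) ^ j • scaledNeumann B j) * (1 - B) = 1 - B ^ 2 ^ j := by
  have hc : ∀ j, Commute (scaledNeumann B j) B := by
    intro j
    induction j with
    | zero => exact Commute.one_left _
    | succ j ih =>
      refine ih.mul_left (Commute.smul_left ?_ _)
      exact (Commute.one_left _).add_left ((Commute.refl B).pow_left _)
  induction j with
  | zero => simp [scaledNeumann]
  | succ j ih =>
    have h2 : Commute (1 + B ^ 2 ^ j) (1 - B) :=
      ((Commute.one_left _).add_left (((Commute.one_right _).sub_right ((Commute.refl B).pow_left _))))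
    have : ((2 : ℝ) ^ (j + 1) • scaledNeumann B (j + 1)) * (1 - B)
        = (((2 : ℝ) ^ j • scaledNeumann B j) * (1 - B)) * (1 + B ^ 2 ^ j) := by
      rw [scaledNeumann, mul_assoc _ (1 - B), ← h2.eq, mul_smul_comm, smul_smul, pow_succ]
      simp only [smul_mul_assoc, mul_assoc]
      norm_num
    rw [this, ih, pow_succ, pow_mul]
    noncomm_ring

lemma norm_inverse_sub_scaledNeumann_le {B S : R} (h1 : ‖(1 : R)‖ ≤ 1) {δ : ℝ} (hδ : δ < 1)
    (hB : ‖B‖ ≤ δ) (hS : (1 - B) * S = 1) (j : ℕ) :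
    ‖S - (2 : ℝ) ^ j • scaledNeumann B j‖ ≤ δ ^ 2 ^ j / (1 - δ) := by
  have e : S - (2 : ℝ) ^ j • scaledNeumann B j = B ^ 2 ^ j * S := by
    have := congrArg (· * S) (two_pow_smul_scaledNeumann_mul B j)
    simp only [mul_assoc, hS, mul_one, sub_mul, one_mul] at this
    rw [this]
    abel
  rw [e, div_eq_mul_one_div]
  refine (norm_mul_le _ _).trans (mul_le_mul ?_ (norm_inverse_le h1 hδ hB hS) (norm_nonneg _) ?_)
  · exact (norm_pow_le' B (by positivity)).trans (pow_le_pow_left₀ (norm_nonneg _) hB _)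
  · exact pow_nonneg ((norm_nonneg _).trans hB) _

/-- The pair `(b, q)` approximates `B ^ 2 ^ j` and the scaled Neumann sum up to the accumulated
errors of products of accuracy `E`. -/
def NeumannApprox (E : ℝ) (B : R) (j : ℕ) (b q : R) : Prop :=
  ‖b - B ^ 2 ^ j‖ ≤ (2 ^ j - 1) * E ∧
    ‖q - scaledNeumann B j‖ ≤ ((2 ^ j - 2) + (j - 1)) / 2 * E

section

variable {E δ : ℝ} {B b q b' q' : R} {j : ℕ}

lemma NeumannApprox.norm_le_one (h : NeumannApprox E B j b q)
    (hδ : δ < 1) (hB : ‖B‖ ≤ δ) (hE : 2 ^ (j + 1) * E ≤ 1 - δ) (hE₀ : 0 ≤ E) : ‖b‖ ≤ 1 := by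
  have h2 := norm_pow_two_pow_le hδ.le hB j
  have h3 := norm_le_norm_add_norm_sub' b (B ^ 2 ^ j)
  have h4 := h.1
  rw [pow_succ] at hE
  have : 0 ≤ 2 ^ j * E := by positivity
  linarith

lemma NeumannApprox.norm_le_one' (h1 : ‖(1 : R)‖ ≤ 1) (h : NeumannApprox E B j b q) (hj : 1 ≤ j)
    (hδ : δ < 1) (hB : ‖B‖ ≤ δ) (hE : 2 ^ (j + 1) * E ≤ 1 - δ) (hE₀ : 0 ≤ E) : ‖q‖ ≤ 1 := by
  have h2 := norm_scaledNeumann_le h1 hδ.le hB hj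
  have h3 := norm_le_norm_add_norm_sub' q (scaledNeumann B j)
  have h4 := h.2
  rw [pow_succ] at hE
  have h5 : (j : ℝ) ≤ 2 ^ j := by exact_mod_cast (Nat.lt_two_pow_self (n := j)).le
  have := mul_le_mul_of_nonneg_right h5 hE₀
  linarith

/-- The new error is at most `E`, plus the old error of `q`, plus half the error of `b`, because the
other factors are contractions. It is separate from `NeumannApprox.succ` since the last round needs
no further squaring. -/
lemma NeumannApprox.mul_approx (h1 : ‖(1 : R)‖ ≤ 1) (h : NeumannApprox E B j b q) (hj : 1 ≤ j)
    (hδ : δ < 1) (hB : ‖B‖ ≤ δ) (hE : 2 ^ (j + 1) * E ≤ 1 - δ) (hE₀ : 0 ≤ E)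
    (hq' : ‖q' - q * ((1 / 2 : ℝ) • (1 + b))‖ ≤ E) :
    ‖q' - scaledNeumann B (j + 1)‖ ≤ ((2 ^ (j + 1) - 2) + ((j + 1 : ℕ) - 1)) / 2 * E := by
  have hb1 := norm_half_smul_one_add_le h1 (h.norm_le_one hδ hB hE hE₀)
  have hQ := norm_scaledNeumann_le h1 hδ.le hB hj
  have e : q' - scaledNeumann B (j + 1) = (q' - q * ((1 / 2 : ℝ) • (1 + b)))
      + (q - scaledNeumann B j) * ((1 / 2 : ℝ) • (1 + b))
      + scaledNeumann B j * ((1 / 2 : ℝ) • (b - B ^ 2 ^ j)) := by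
    rw [scaledNeumann]
    simp only [sub_mul, mul_smul_comm, mul_add, mul_sub, smul_add, smul_sub]
    abel
  rw [e]
  have h3 := norm_add₃_le (a := (q' - q * ((1 / 2 : ℝ) • (1 + b))))
      (b := (q - scaledNeumann B j) * ((1 / 2 : ℝ) • (1 + b)))
      (c := scaledNeumann B j * ((1 / 2 : ℝ) • (b - B ^ 2 ^ j)))
  have h4 := norm_mul_le (q - scaledNeumann B j) ((1 / 2 : ℝ) • (1 + b))
  have h5 := norm_mul_le (scaledNeumann B j) ((1 / 2 : ℝ) • (b - B ^ 2 ^ j))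
  rw [norm_smul, Real.norm_of_nonneg (by norm_num)] at h5
  have h6 : ‖q - scaledNeumann B j‖ * ‖(1 / 2 : ℝ) • (1 + b)‖ ≤ ‖q - scaledNeumann B j‖ :=
    mul_le_of_le_one_right (norm_nonneg _) (by linarith)
  have h7 : ‖scaledNeumann B j‖ * (1 / 2 * ‖b - B ^ 2 ^ j‖) ≤ 1 / 2 * ‖b - B ^ 2 ^ j‖ :=
    mul_le_of_le_one_left (by positivity) (by linarith)
  have h8 := h.1
  have h9 := h.2
  rw [pow_succ]
  push_cast
  linarith

/-- Squaring contractions at most doubles the error and adds `E`; the recursion `e ↦ 2e + E` from `e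
= E` gives `(2^j - 1) E`. -/
lemma NeumannApprox.succ (h1 : ‖(1 : R)‖ ≤ 1) (h : NeumannApprox E B j b q) (hj : 1 ≤ j)
    (hδ : δ < 1) (hB : ‖B‖ ≤ δ) (hE : 2 ^ (j + 1) * E ≤ 1 - δ) (hE₀ : 0 ≤ E)
    (hb' : ‖b' - b * b‖ ≤ E) (hq' : ‖q' - q * ((1 / 2 : ℝ) • (1 + b))‖ ≤ E) :
    NeumannApprox E B (j + 1) b' q' := by
  refine ⟨?_, h.mul_approx h1 hj hδ hB hE hE₀ hq'⟩
  have hb := h.norm_le_one hδ hB hE hE₀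
  have hB' := norm_pow_two_pow_le hδ.le hB j
  have e : b' - B ^ 2 ^ (j + 1) = (b' - b * b) + (b - B ^ 2 ^ j) * b + B ^ 2 ^ j * (b - B ^ 2 ^ j) := by
    rw [pow_succ 2, pow_mul]
    noncomm_ring
  rw [e]
  have h3 := norm_add₃_le (a := (b' - b * b)) (b := (b - B ^ 2 ^ j) * b)
    (c := B ^ 2 ^ j * (b - B ^ 2 ^ j))
  have h4 := (norm_mul_le (b - B ^ 2 ^ j) b).trans (mul_le_of_le_one_right (norm_nonneg _) hb)
  have h5 := (norm_mul_le (B ^ 2 ^ j) (b - B ^ 2 ^ j)).trans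
    (mul_le_of_le_one_left (norm_nonneg _) (hB'.trans hδ.le))
  have h6 := h.1
  rw [pow_succ]
  linarith

lemma NeumannApprox.one (hb : ‖b - B * B‖ ≤ E) :
    NeumannApprox E B 1 b ((1 / 2 : ℝ) • (1 + B)) := by
  constructor
  · norm_num
    rwa [sq]
  · simp [scaledNeumann]

end

end NormedRing

/-! ### The number of terms and the accuracy of the products -/

lemma one_le_neumannLevel (e δ : ℝ) : 1 ≤ neumannLevel e δ := by
  unfold neumannLevel
  split <;> simp

lemma pow_neumannLevel_le {e δ : ℝ} (he : 0 < e) (hδ₀ : 0 < δ) (hδ₁ : δ < 1) :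
    δ ^ 2 ^ neumannLevel e δ ≤ e * (1 - δ) := by
  have hy : 0 < e * (1 - δ) := mul_pos he (by linarith)
  by_cases h : e * (1 - δ) < 1
  · have hδ : Real.log δ < 0 := Real.log_neg hδ₀ hδ₁
    have hl : Real.log (e * (1 - δ)) < 0 := Real.log_neg hy h
    have hx : Real.logb 2 (e * (1 - δ)) / Real.logb 2 δ = Real.log (e * (1 - δ)) / Real.log δ := by
      unfold Real.logb
      rw [div_div_div_cancel_right₀ (Real.log_pos (by norm_num)).ne']
    have hx0 : 0 < Real.log (e * (1 - δ)) / Real.log δ := div_pos_of_neg_of_neg hl hδ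
    have h1 : Real.logb 2 (Real.log (e * (1 - δ)) / Real.log δ) ≤ neumannLevel e δ := by
      rw [neumannLevel, if_pos h, hx]
      exact (Nat.le_ceil _).trans (by exact_mod_cast le_max_left _ _)
    rw [Real.logb_le_iff_le_rpow (by norm_num) hx0, Real.rpow_natCast,
      div_le_iff_of_neg hδ] at h1
    rw [← Real.log_le_log_iff (by positivity) hy, Real.log_pow]
    push_cast
    exact h1
  · exact (pow_le_one₀ hδ₀.le hδ₁.le).trans (not_lt.1 h)

/-- With `y = e(1 - δ) < 1/2` one has `log₂ y ≤ -1`, so `log₂(y/2) = log₂ y - 1 ≥ 2 log₂ y`. The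
inner quotient at most doubles, and the outer logarithm grows by at most 1. For `y` close to 1 this
fails, as `log₂ y` is close to 0. -/
lemma neumannLevel_half_le {e δ : ℝ} (he : 0 < e) (hδ₀ : 0 < δ) (hδ₁ : δ < 1)
    (h : e * (1 - δ) < 1 / 2) : neumannLevel (e / 2) δ ≤ neumannLevel e δ + 1 := by
  have hy : 0 < e * (1 - δ) := mul_pos he (by linarith)
  have hδ : Real.logb 2 δ < 0 := Real.logb_neg (by norm_num) hδ₀ hδ₁
  have e1 : e / 2 * (1 - δ) = e * (1 - δ) / 2 := by ring
  have e2 : Real.logb 2 (e * (1 - δ) / 2) = Real.logb 2 (e * (1 - δ)) - 1 := by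
    rw [Real.logb_div hy.ne' (by norm_num), Real.logb_self_eq_one (by norm_num)]
  have hl : Real.logb 2 (e * (1 - δ)) ≤ -1 := by
    rw [Real.logb_le_iff_le_rpow (by norm_num) hy, Real.rpow_neg_one]
    linarith
  have hx : 0 < Real.logb 2 (e * (1 - δ)) / Real.logb 2 δ :=
    div_pos_of_neg_of_neg (by linarith) hδ
  rw [neumannLevel, neumannLevel, if_pos (by rw [e1]; linarith), if_pos (by linarith), e1, e2]
  have h2 : Real.logb 2 ((Real.logb 2 (e * (1 - δ)) - 1) / Real.logb 2 δ)
      ≤ Real.logb 2 (Real.logb 2 (e * (1 - δ)) / Real.logb 2 δ) + 1 := by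
    have h3 : (Real.logb 2 (e * (1 - δ)) - 1) / Real.logb 2 δ
        ≤ Real.logb 2 (e * (1 - δ)) / Real.logb 2 δ * 2 := by
      rw [div_mul_eq_mul_div]
      exact div_le_div_of_nonpos_of_le hδ.le (by linarith)
    refine (Real.logb_le_logb_of_le (by norm_num)
      (div_pos_of_neg_of_neg (by linarith) hδ) h3).trans (le_of_eq ?_)
    rw [Real.logb_mul hx.ne' (by norm_num), Real.logb_self_eq_one (by norm_num)]
  refine max_le ?_ (by omega)
  rw [Nat.ceil_le]
  refine h2.trans ?_
  push_cast
  have h4 := Nat.le_ceil (Real.logb 2 (Real.logb 2 (e * (1 - δ)) / Real.logb 2 δ))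
  have h5 := le_max_left ((⌈Real.logb 2 (Real.logb 2 (e * (1 - δ)) / Real.logb 2 δ)⌉₊ : ℝ)) 1
  linarith

lemma sq_le_three_mul_two_pow (m : ℕ) : m ^ 2 ≤ 3 * 2 ^ m := by
  induction m with
  | zero => simp
  | succ m ih =>
    rcases Nat.lt_or_ge m 3 with h | h
    · interval_cases m <;> norm_num
    · rw [pow_succ 2]
      nlinarith

lemma three_mul_sq_le_two_pow {m : ℕ} (hm : 8 ≤ m) : 3 * m ^ 2 ≤ 2 * 2 ^ m := by
  induction m, hm using Nat.le_induction with
  | base => norm_num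
  | succ m hm ih =>
    rw [pow_succ 2]
    nlinarith

/-- Equality holds for `i = 1`, so small cases are checked by hand; from `2^(i+1) ≥ 8` on, the
double exponential dominates. -/
lemma error_count_le {i : ℕ} :
    2 ^ (i + 1) * (2 ^ (i + 2) - 2 + (i + 1)) ≤ 2 * 2 ^ 2 ^ (i + 1) := by
  rcases Nat.lt_or_ge i 2 with h | h
  · interval_cases i <;> norm_num
  · have h8 : 8 ≤ 2 ^ (i + 1) :=
      le_trans (by norm_num) (Nat.pow_le_pow_right (by norm_num) (by omega : 3 ≤ i + 1))
    refine le_trans ?_ (three_mul_sq_le_two_pow h8)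
    have : i + 1 ≤ 2 ^ (i + 1) := Nat.lt_two_pow_self.le
    have e : 2 ^ (i + 2) = 2 * 2 ^ (i + 1) := by ring
    calc 2 ^ (i + 1) * (2 ^ (i + 2) - 2 + (i + 1)) ≤ 2 ^ (i + 1) * (3 * 2 ^ (i + 1)) :=
          Nat.mul_le_mul_left _ (by omega)
      _ = 3 * (2 ^ (i + 1)) ^ 2 := by ring

section

variable {η δ E : ℝ} {i : ℕ}

/-- The bound on `E` does not mention `δ`, so `1 - δ` must be bounded below. Bernoulli gives `1 -
2^N (1 - δ) ≤ δ^(2^N) ≤ 1/4` for `N = i + 2`, thus `2^N (1 - δ) ≥ 3/4`, and `4^N E ≤ 3/4` suffices.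
-/
lemma two_pow_mul_error_le (hδ₀ : 0 < δ) (hδ₁ : δ < 1) (hη : η * (1 - δ) < 1 / 2)
    (hN : δ ^ 2 ^ (i + 2) ≤ η / 2 * (1 - δ)) (hE : E ≤ (2 ^ 2 ^ (i + 1))⁻¹ * (min η (1 / 4) / 4)) :
    2 ^ (i + 2) * E ≤ 1 - δ := by
  have hb := one_add_mul_le_pow (a := δ - 1) (by linarith) (2 ^ (i + 2))
  rw [add_sub_cancel] at hb
  push_cast at hb
  have e : (2 : ℝ) ^ (i + 2) = 2 * 2 ^ (i + 1) := by ring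
  have h1 : ((2 : ℝ) ^ (i + 1)) ^ 2 ≤ 3 * 2 ^ 2 ^ (i + 1) := by
    exact_mod_cast sq_le_three_mul_two_pow (2 ^ (i + 1))
  rw [e] at hb ⊢
  set m : ℝ := 2 ^ (i + 1)
  have hm : 0 < m := by positivity
  set P : ℝ := 2 ^ 2 ^ (i + 1)
  have hP : 0 < P := by positivity
  have h2 : E ≤ P⁻¹ * (1 / 16) := by
    refine hE.trans (mul_le_mul_of_nonneg_left ?_ (by positivity))
    have := min_le_right η (1 / 4)
    linarith
  have h3 : 2 * m * E ≤ 2 * m * (P⁻¹ * (1 / 16)) := mul_le_mul_of_nonneg_left h2 (by positivity)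
  refine h3.trans ?_
  have h4 : 3 / 4 ≤ 2 * m * (1 - δ) := by linarith
  have h5 : 2 * m * (2 * m * (P⁻¹ * (1 / 16))) ≤ 2 * m * (1 - δ) := by
    refine le_trans ?_ h4
    have : 2 * m * (2 * m * (P⁻¹ * (1 / 16))) = m ^ 2 / P / 4 := by
      field_simp
      ring
    rw [this]
    have : m ^ 2 / P ≤ 3 := (div_le_iff₀ hP).2 h1
    linarith
  exact le_of_mul_le_mul_left h5 (by positivity)

lemma final_error_le (hη : 0 < η) (hE₀ : 0 ≤ E)
    (hE : E ≤ (2 ^ 2 ^ (i + 1))⁻¹ * (min η (1 / 4) / 4)) :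
    2 ^ (i + 2) * (((2 ^ (i + 2) - 2) + ((i + 2 : ℕ) - 1)) / 2 * E) ≤ η / 2 := by
  have h0 : (2 : ℕ) ≤ 2 ^ (i + 2) := by
    calc 2 ≤ 2 ^ 2 := by norm_num
      _ ≤ 2 ^ (i + 2) := Nat.pow_le_pow_right (by norm_num) (by omega)
  have h1 : (2 : ℝ) ^ (i + 1) * (2 ^ (i + 2) - 2 + (i + 1)) ≤ 2 * 2 ^ 2 ^ (i + 1) := by
    have := error_count_le (i := i)
    have h := (Nat.cast_le (α := ℝ)).2 this
    push_cast [Nat.cast_sub h0] at h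
    exact h
  set P : ℝ := 2 ^ 2 ^ (i + 1)
  have hP : 0 < P := by positivity
  have h2 : P * E ≤ η / 4 := by
    have h3 : E ≤ P⁻¹ * (η / 4) := by
      refine hE.trans (mul_le_mul_of_nonneg_left ?_ (by positivity))
      have := min_le_left η (1 / 4)
      linarith
    calc P * E ≤ P * (P⁻¹ * (η / 4)) := mul_le_mul_of_nonneg_left h3 hP.le
      _ = η / 4 := by field_simp
  have h4 := mul_le_mul_of_nonneg_right h1 hE₀
  have e : (2 : ℝ) ^ (i + 2) * (((2 ^ (i + 2) - 2) + ((i + 2 : ℕ) - 1)) / 2 * E)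
      = 2 ^ (i + 1) * (2 ^ (i + 2) - 2 + (i + 1)) * E := by
    push_cast
    ring
  rw [e]
  linarith

end

/-! ### Powers with exponent `⌈log₂ n⌉` -/

lemma two_pow_clog_le {n : ℕ} (hn : 1 ≤ n) : 2 ^ Nat.clog 2 n ≤ 2 * n := by
  rcases hn.eq_or_lt with rfl | h
  · simp
  · have h1 := Nat.pow_pred_clog_lt_self (b := 2) (by norm_num) h
    have h2 : 0 < Nat.clog 2 n := Nat.clog_pos (by norm_num) h
    obtain ⟨k, hk⟩ := Nat.exists_eq_succ_of_ne_zero h2.ne'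
    rw [hk, Nat.pred_succ] at h1
    rw [hk, pow_succ]
    omega

lemma cast_clog_le {n : ℕ} (hn : 1 ≤ n) : (Nat.clog 2 n : ℝ) ≤ Real.logb 2 n + 1 := by
  have hn' : (0 : ℝ) < n := by exact_mod_cast hn
  have h : ((2 : ℝ) ^ Nat.clog 2 n) ≤ n * 2 := by
    rw [mul_comm]
    exact_mod_cast two_pow_clog_le hn
  have h1 := Real.logb_le_logb_of_le (b := 2) (by norm_num) (by positivity) h
  rwa [Real.logb_mul hn'.ne' (by norm_num), Real.logb_self_eq_one (by norm_num), Real.logb_pow,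
    Real.logb_self_eq_one (by norm_num), mul_one] at h1

lemma seven_pow_clog_le {n : ℕ} (hn : 1 ≤ n) :
    (7 : ℝ) ^ Nat.clog 2 n ≤ 7 * (n : ℝ) ^ Real.logb 2 7 := by
  have hn' : (0 : ℝ) < n := by exact_mod_cast hn
  have h7 : (2 : ℝ) ^ Real.logb 2 7 = 7 := Real.rpow_logb (by norm_num) (by norm_num) (by norm_num)
  have h : ((2 : ℝ) ^ Nat.clog 2 n) ≤ 2 * n := by exact_mod_cast two_pow_clog_le hn
  calc (7 : ℝ) ^ Nat.clog 2 n = ((2 : ℝ) ^ Nat.clog 2 n) ^ Real.logb 2 7 := by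
        rw [← Real.rpow_natCast 2, ← Real.rpow_mul (by norm_num), mul_comm, Real.rpow_mul (by norm_num),
          h7, Real.rpow_natCast]
    _ ≤ (2 * n) ^ Real.logb 2 7 :=
        Real.rpow_le_rpow (by positivity) h (Real.logb_nonneg (by norm_num) (by norm_num))
    _ = 7 * (n : ℝ) ^ Real.logb 2 7 := by
        rw [Real.mul_rpow (by norm_num) hn'.le, h7]

lemma sq_le_four_pow_clog (n : ℕ) : (n : ℝ) ^ 2 ≤ 4 ^ Nat.clog 2 n := by
  have h : (n : ℝ) ≤ 2 ^ Nat.clog 2 n := by exact_mod_cast Nat.le_pow_clog (by norm_num) n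
  calc (n : ℝ) ^ 2 ≤ (2 ^ Nat.clog 2 n) ^ 2 := by gcongr
    _ = 4 ^ Nat.clog 2 n := by
      rw [← pow_mul, mul_comm, pow_mul]
      norm_num

lemma four_pow_clog_le {n : ℕ} (hn : 1 ≤ n) : (4 : ℝ) ^ Nat.clog 2 n ≤ 4 * n ^ 2 := by
  have h : ((2 : ℝ) ^ Nat.clog 2 n) ≤ 2 * n := by exact_mod_cast two_pow_clog_le hn
  calc (4 : ℝ) ^ Nat.clog 2 n = (2 ^ Nat.clog 2 n) ^ 2 := by
        rw [← pow_mul, mul_comm _ 2, pow_mul]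
        norm_num
    _ ≤ (2 * n) ^ 2 := by gcongr
    _ = 4 * n ^ 2 := by ring

/-! ### Networks for the truncated Neumann series -/

/-- The square matrix with the given entries. -/
def toMat {n : ℕ} (x : Fin n × Fin n → ℝ) : Matrix (Fin n) (Fin n) ℝ :=
  Matrix.of fun i j => x (i, j)

/-- The entries of a multiple of the identity matrix. -/
def scalarEntries (n : ℕ) (a : ℝ) (p : Fin n × Fin n) : ℝ :=
  if p.1 = p.2 then a else 0

lemma sum_nz_scalarEntries (n : ℕ) {a : ℝ} : ∑ p, nz (scalarEntries n a p) = n * nz a := by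
  simp [scalarEntries, Fintype.sum_prod_type, nz_ite_zero]

lemma sum_nz_scalarEntries_le (n : ℕ) (a : ℝ) : ∑ p, nz (scalarEntries n a p) ≤ n ^ 2 := by
  rw [sum_nz_scalarEntries, sq]
  rcases Nat.eq_zero_or_pos n with rfl | h
  · simp
  · exact Nat.mul_le_mul_left _ ((nz_le_one a).trans h)

lemma toMat_scalarEntries_add {n : ℕ} (a c : ℝ) (x : Fin n × Fin n → ℝ) :
    toMat (fun p => c * x p + scalarEntries n a p) = a • 1 + c • toMat x := by
  ext i j
  simp [toMat, scalarEntries, Matrix.one_apply, add_comm]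

lemma layerWeights_entrywise {ι κ : Type} [Fintype ι] [Fintype κ] [DecidableEq ι] (s : κ → ι)
    (c C : κ → ℝ) :
    layerWeights (fun k i => if i = s k then c k else 0) C = ∑ k, nz (c k) + ∑ k, nz (C k) := by
  simp [layerWeights, nz_ite_zero, Finset.sum_add_distrib]

lemma IsLayer.of_entrywise {ϱ : ℝ → ℝ} {ι κ : Type} [Fintype ι] [Fintype κ] {w : ℕ}
    {f : (ι → ℝ) → κ → ℝ} (s : κ → ι) (c C : κ → ℝ) (hf : ∀ x k, f x k = c k * x (s k) + C k)
    (hw : Fintype.card κ + ∑ k, nz (C k) ≤ w) : IsLayer ϱ w f := by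
  classical
  refine IsLayer.of_affine (fun k i => if i = s k then c k else 0) C ?_ fun x k => ?_
  · rw [layerWeights_entrywise]
    refine le_trans (Nat.add_le_add_right ?_ _) hw
    refine (Finset.sum_le_sum fun k _ => nz_le_one (c k)).trans ?_
    simp
  · rw [hf]
    simp

/-- `g` approximates the product of two contractions up to `E` in the operator norm. -/
def NormApproxMul {n : ℕ} (E : ℝ) (g : ((Fin n × Fin n) ⊕ (Fin n × Fin n) → ℝ) → Fin n × Fin n → ℝ) :
    Prop :=
  ∀ x y : Fin n × Fin n → ℝ, ‖toMat x‖ ≤ 1 → ‖toMat y‖ ≤ 1 →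
    ‖toMat (g (Sum.elim x y)) - toMat x * toMat y‖ ≤ E

lemma ApproxMul.normApproxMul {n : ℕ} {K σ : ℝ} (hσ : 0 ≤ σ)
    {g : ((Fin n × Fin n) ⊕ (Fin n × Fin n) → ℝ) → Fin n × Fin n → ℝ} (hg : ApproxMul K σ g)
    (hK : 1 ≤ K) : NormApproxMul (n * σ) g := by
  intro x y hx hy
  refine l2_opNorm_le_of_abs_entry_le hσ fun i j => ?_
  refine hg (Sum.elim x y) ?_ i j
  rintro (⟨i, j⟩ | ⟨i, j⟩)
  · exact (abs_entry_le_l2_opNorm (toMat x) i j).trans (hx.trans hK)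
  · exact (abs_entry_le_l2_opNorm (toMat y) i j).trans (hy.trans hK)

section

variable {ϱ : ℝ → ℝ} {n ℓ W : ℕ} {E : ℝ}
  {g : ((Fin n × Fin n) ⊕ (Fin n × Fin n) → ℝ) → Fin n × Fin n → ℝ}

/-- Two copies of `B = 1 - αA` feed the first squaring; the third entry is `(1 + B)/2 = 1 - αA/2`,
the first scaled Neumann sum, available without a product. -/
lemma isLayer_init (α : ℝ) : IsLayer ϱ (6 * n ^ 2) (fun x : Fin n × Fin n → ℝ =>
    Sum.elim (Sum.elim (fun p => -α * x p + scalarEntries n 1 p)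
      (fun p => -α * x p + scalarEntries n 1 p)) (fun p => -α / 2 * x p + scalarEntries n 1 p)) := by
  refine IsLayer.of_entrywise (Sum.elim (Sum.elim id id) id)
    (Sum.elim (Sum.elim (fun _ => -α) (fun _ => -α)) (fun _ => -α / 2))
    (Sum.elim (Sum.elim (scalarEntries n 1) (scalarEntries n 1)) (scalarEntries n 1)) ?_ ?_
  · rintro x ((p | p) | p) <;> rfl
  · have := sum_nz_scalarEntries_le n 1
    simp only [Fintype.card_sum, Fintype.card_prod, Fintype.card_fin, Fintype.sum_sum_type,
      Sum.elim_inl, Sum.elim_inr]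
    nlinarith

/-- Prepares a round from the pair `(b, q)`: the factors of `b · b` and those of `q · (1 + b)/2`,
multiplied in parallel. -/
lemma isLayer_duplicate : IsLayer ϱ (5 * n ^ 2) (fun x : (Fin n × Fin n) ⊕ (Fin n × Fin n) → ℝ =>
    Sum.elim (Sum.elim (fun p => x (Sum.inl p)) (fun p => x (Sum.inl p)))
      (Sum.elim (fun p => x (Sum.inr p))
        (fun p => 1 / 2 * x (Sum.inl p) + scalarEntries n (1 / 2) p))) := by
  refine IsLayer.of_entrywise (Sum.elim (Sum.elim Sum.inl Sum.inl) (Sum.elim Sum.inr Sum.inl))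
    (Sum.elim (Sum.elim 1 1) (Sum.elim 1 (fun _ => 1 / 2)))
    (Sum.elim (Sum.elim 0 0) (Sum.elim 0 (scalarEntries n (1 / 2)))) ?_ ?_
  · rintro x ((p | p) | (p | p)) <;> simp
  · have := sum_nz_scalarEntries_le n (1 / 2)
    simp only [Fintype.card_sum, Fintype.card_prod, Fintype.card_fin, Fintype.sum_sum_type,
      Sum.elim_inl, Sum.elim_inr, Pi.zero_apply, nz_zero, Finset.sum_const_zero]
    nlinarith

lemma isLayer_lastFactors : IsLayer ϱ (3 * n ^ 2)
    (fun x : (Fin n × Fin n) ⊕ (Fin n × Fin n) → ℝ =>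
      Sum.elim (fun p => x (Sum.inr p))
        (fun p => 1 / 2 * x (Sum.inl p) + scalarEntries n (1 / 2) p)) := by
  refine IsLayer.of_entrywise (Sum.elim Sum.inr Sum.inl)
    (Sum.elim 1 (fun _ => 1 / 2)) (Sum.elim 0 (scalarEntries n (1 / 2))) ?_ ?_
  · rintro x (p | p) <;> simp
  · have := sum_nz_scalarEntries_le n (1 / 2)
    simp only [Fintype.card_sum, Fintype.card_prod, Fintype.card_fin, Fintype.sum_sum_type,
      Sum.elim_inl, Sum.elim_inr, Pi.zero_apply, nz_zero, Finset.sum_const_zero]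
    nlinarith

lemma norm_matrix_one_le (n : ℕ) : ‖(1 : Matrix (Fin n) (Fin n) ℝ)‖ ≤ 1 := by
  rw [Matrix.cstar_norm_def, map_one]
  exact ContinuousLinearMap.norm_id_le

lemma toMat_half_add (x : Fin n × Fin n → ℝ) :
    toMat (fun p => 1 / 2 * x p + scalarEntries n (1 / 2) p) = (1 / 2 : ℝ) • (1 + toMat x) := by
  rw [toMat_scalarEntries_add, smul_add]

lemma NeumannApprox.norm_half_le {B : Matrix (Fin n) (Fin n) ℝ} {δ : ℝ} {j : ℕ}
    {b q : Matrix (Fin n) (Fin n) ℝ} (h : NeumannApprox E B j b q)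
    (hδ : δ < 1) (hB : ‖B‖ ≤ δ) (hE : 2 ^ (j + 1) * E ≤ 1 - δ) (hE₀ : 0 ≤ E) :
    ‖(1 / 2 : ℝ) • (1 + b)‖ ≤ 1 := by
  simpa using norm_half_smul_one_add_le (norm_matrix_one_le n) (h.norm_le_one hδ hB hE hE₀)

/-- A chain of layers that computes `B ^ 2 ^ (i + 1)` and the scaled Neumann sum with
`2 ^ (i + 1)` terms, where `B = 1 - α A`. -/
lemma exists_neumann_chain (hg : Chain ϱ ℓ W g) (hgE : NormApproxMul E g) (hE₀ : 0 ≤ E) (α : ℝ)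
    {δ : ℝ} (hδ : δ < 1) (i : ℕ) (hE : 2 ^ (i + 1) * E ≤ 1 - δ) :
    ∃ f : (Fin n × Fin n → ℝ) → (Fin n × Fin n) ⊕ (Fin n × Fin n) → ℝ,
      Chain ϱ ((i + 1) * (ℓ + 1)) ((ℓ + 6) * n ^ 2 + W + i * (5 * n ^ 2 + 2 * W)) f ∧
      ∀ x, ‖1 - α • toMat x‖ ≤ δ → NeumannApprox E (1 - α • toMat x) (i + 1)
        (toMat fun p => f x (Sum.inl p)) (toMat fun p => f x (Sum.inr p)) := by
  induction i with
  | zero =>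
    -- While `B` is squared, the sum waits in a parallel identity chain; this is the source of the
    -- term `ℓ n²`.
    have h := (hg.par (Chain.identity (ι := Fin n × Fin n) ℓ)).comp
      (Chain.of_layer (isLayer_init (ϱ := ϱ) (n := n) α))
    refine ⟨_, h.cast (by ring) (by simp only [Fintype.card_prod, Fintype.card_fin]; ring), ?_⟩
    intro x hx
    have e : toMat (fun p => -α * x p + scalarEntries n 1 p) = 1 - α • toMat x := by
      rw [toMat_scalarEntries_add, one_smul, neg_smul, sub_eq_add_neg]
    have e' : toMat (fun p => -α / 2 * x p + scalarEntries n 1 p)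
        = (1 / 2 : ℝ) • (1 + (1 - α • toMat x)) := by
      rw [toMat_scalarEntries_add]
      module
    have h1 : ‖toMat (fun p => -α * x p + scalarEntries n 1 p)‖ ≤ 1 := by
      rw [e]
      exact hx.trans hδ.le
    have h2 := hgE _ _ h1 h1
    have h3 := NeumannApprox.one (h2.trans_eq' (by rw [e]))
    rw [← e'] at h3
    exact h3
  | succ i ih =>
    obtain ⟨f, hf, hfE⟩ := ih (le_trans (mul_le_mul_of_nonneg_right
      (pow_le_pow_right₀ (by norm_num) (by omega)) hE₀) hE)
    have h := ((hg.par hg).comp (Chain.of_layer (isLayer_duplicate (ϱ := ϱ) (n := n)))).comp hf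
    refine ⟨_, h.cast (by ring) (by ring), ?_⟩
    intro x hx
    have hN := hfE x hx
    have hb := hN.norm_le_one hδ hx hE hE₀
    have hq := hN.norm_le_one' (norm_matrix_one_le n) (by omega) hδ hx hE hE₀
    have hh := hN.norm_half_le hδ hx hE hE₀
    rw [← toMat_half_add] at hh
    have h2 := hgE _ _ hq hh
    rw [toMat_half_add] at h2
    exact hN.succ (norm_matrix_one_le n) (by omega) hδ hx hE hE₀ (hgE _ _ hb hb) h2

/-- A matrix neural network that approximates the inverse by `2 ^ (i + 2)` terms of the Neumann
series. -/
lemma exists_mnn_inverse (hg : Chain ϱ ℓ W g) (hgE : NormApproxMul E g) (hE₀ : 0 ≤ E) (α : ℝ)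
    {δ : ℝ} (hδ : δ < 1) (i : ℕ) (hE : 2 ^ (i + 2) * E ≤ 1 - δ) :
    ∃ Φ : MNN ϱ n n n n, Φ.numLayers = (i + 2) * (ℓ + 1) + 1 ∧
      Φ.numWeights ≤ (ℓ + 10 + 5 * i) * n ^ 2 + 2 * (i + 1) * W ∧
      ∀ A : Matrix (Fin n) (Fin n) ℝ, ‖1 - α • A‖ ≤ δ →
        ∃ q, Φ.realize A = α • (2 : ℝ) ^ (i + 2) • q ∧
          ‖q - scaledNeumann (1 - α • A) (i + 2)‖
            ≤ ((2 ^ (i + 2) - 2) + ((i + 2 : ℕ) - 1)) / 2 * E := by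
  obtain ⟨f, hf, hfE⟩ := exists_neumann_chain hg hgE hE₀ α hδ i (le_trans (mul_le_mul_of_nonneg_right
      (pow_le_pow_right₀ (by norm_num) (by omega)) hE₀) hE)
  have h := (hg.comp (Chain.of_layer (isLayer_lastFactors (ϱ := ϱ) (n := n)))).comp hf
  -- The closing affine layer undoes the `i + 2` halvings and multiplies by `α`.
  obtain ⟨Φ, hL, hW, hΦ⟩ := h.exists_mnn (Equiv.refl _)
    (fun k i' => if i' = k then α * 2 ^ (i + 2) else 0) 0
  refine ⟨Φ, by rw [hL]; ring, ?_, ?_⟩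
  · have h1 := layerWeights_entrywise (fun k : Fin n × Fin n => k) (fun _ => α * 2 ^ (i + 2)) 0
    have h2 : ∑ _k : Fin n × Fin n, nz (α * 2 ^ (i + 2)) ≤ n ^ 2 := by
      refine (Finset.sum_le_sum fun k _ => nz_le_one _).trans ?_
      simp [sq]
    simp only [Pi.zero_apply, nz_zero, Finset.sum_const_zero, add_zero] at h1
    rw [h1] at hW
    nlinarith
  · intro A hA
    have hA' : ‖1 - α • toMat (fun q => A q.1 q.2)‖ ≤ δ := hA
    have hN := hfE _ hA'
    have hq := hN.norm_le_one' (norm_matrix_one_le n) (by omega) hδ hA' hE hE₀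
    have hh := hN.norm_half_le hδ hA' hE hE₀
    rw [← toMat_half_add] at hh
    have h2 := hgE _ _ hq hh
    rw [toMat_half_add] at h2
    have h3 := hN.mul_approx (norm_matrix_one_le n) (by omega) hδ hA' hE hE₀ h2
    refine ⟨_, ?_, h3⟩
    ext a b
    rw [hΦ]
    simp [toMat, mul_assoc]

end

/-! ### Approximate inverses in the three regimes -/

section

variable {n : ℕ} {A : Matrix (Fin n) (Fin n) ℝ} {α δ : ℝ}

lemma isUnit_of_norm_one_sub_smul_le (hδ : δ < 1) (hA : ‖1 - α • A‖ ≤ δ) :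
    IsUnit A := by
  have h := isUnit_one_sub_of_norm_lt_one (hA.trans_lt hδ)
  rw [sub_sub_cancel] at h
  rw [Matrix.isUnit_iff_isUnit_det] at h ⊢
  rw [Matrix.det_smul] at h
  exact isUnit_of_mul_isUnit_right h

/-- Approximations of the inverse of `α A` give approximations of the inverse of `A`. -/
lemma norm_inverse_sub_smul_le (hα : α ≠ 0) (hδ : δ < 1) (hA : ‖1 - α • A‖ ≤ δ)
    {ε : ℝ} (X : Matrix (Fin n) (Fin n) ℝ)
    (hX : ∀ S : Matrix (Fin n) (Fin n) ℝ, (1 - (1 - α • A)) * S = 1 → ‖S - X‖ ≤ ε / |α|) :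
    ‖A⁻¹ - α • X‖ ≤ ε := by
  have hu := (Matrix.isUnit_iff_isUnit_det _).1 (isUnit_of_norm_one_sub_smul_le hδ hA)
  have h := hX (α⁻¹ • A⁻¹) (by
    rw [sub_sub_cancel, smul_mul_smul_comm, mul_inv_cancel₀ hα, Matrix.mul_nonsing_inv _ hu,
      one_smul])
  have e : A⁻¹ - α • X = α • (α⁻¹ • A⁻¹ - X) := by
    rw [smul_sub, smul_smul, mul_inv_cancel₀ hα, one_smul]
  rw [e, norm_smul, Real.norm_eq_abs]
  rwa [le_div_iff₀' (abs_pos.2 hα)] at h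

end

lemma MatTensor.apply_diagonal {n : ℕ} (c : ℝ) (A : Matrix (Fin n) (Fin n) ℝ) :
    MatTensor.apply (fun i j k l => if (k, l) = (i, j) then c else 0) A = c • A := by
  ext i j
  rw [MatTensor.apply_eq_sum]
  simp

lemma numWeights_diagonal {n : ℕ} {c a : ℝ} (hc : c ≠ 0) (ha : a ≠ 0) :
    MatTensor.numNonzero (fun i j k l => if (k, l) = (i, j) then c else 0 : MatTensor n n n n)
      + matNumNonzero (a • (1 : Matrix (Fin n) (Fin n) ℝ)) = n ^ 2 + n := by
  rw [← layerWeights_eq, ← layerWeights_reindex _ _ (Equiv.refl _) (Equiv.refl _)]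
  have h := layerWeights_entrywise (fun k : Fin n × Fin n => k) (fun _ => c) (scalarEntries n a)
  rw [sum_nz_scalarEntries, nz_of_ne ha, nz_of_ne hc] at h
  simp only [Finset.sum_const, Finset.card_univ, Fintype.card_prod, Fintype.card_fin, smul_eq_mul,
    mul_one] at h
  rw [sq, ← h]
  congr 1
  funext p
  simp [scalarEntries, Matrix.one_apply]

/-- The two-layer network for two terms of the Neumann series. -/
lemma exists_mnn_two_terms (ϱ : ℝ → ℝ) (n : ℕ) {α : ℝ} (hα : α ≠ 0) :
    ∃ Φ : MNN ϱ n n n n, Φ.numWeights = 2 * (n ^ 2 + n) ∧ Φ.numLayers = 2 ∧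
      ∀ A, Φ.realize A = α • (1 + (1 - α • A)) := by
  refine ⟨MNN.cons (fun i j k l => if (k, l) = (i, j) then -α else 0) ((1 : ℝ) • 1)
    (fun _ _ => id) (fun _ _ => Or.inl rfl)
    (MNN.last (fun i j k l => if (k, l) = (i, j) then α else 0) (α • 1)), ?_, rfl, fun A => ?_⟩
  · rw [MNN.numWeights, MNN.numWeights, numWeights_diagonal (neg_ne_zero.2 hα) one_ne_zero,
      numWeights_diagonal hα hα]
    ring
  · rw [MNN.realize, MNN.realize, MatTensor.apply_diagonal, MatTensor.apply_diagonal]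
    have : (Matrix.of fun i j => id ((-α • A + (1 : ℝ) • (1 : Matrix (Fin n) (Fin n) ℝ)) i j))
        = -α • A + (1 : ℝ) • (1 : Matrix (Fin n) (Fin n) ℝ) := rfl
    rw [this]
    module

/-- The one-layer network with a constant multiple of the identity as value. -/
lemma exists_mnn_const (ϱ : ℝ → ℝ) (n : ℕ) (a : ℝ) :
    ∃ Φ : MNN ϱ n n n n, Φ.numWeights ≤ n ^ 2 ∧ Φ.numLayers = 1 ∧
      ∀ A, Φ.realize A = a • 1 := by
  refine ⟨MNN.last 0 (a • 1), ?_, rfl, fun A => ?_⟩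
  · rw [MNN.numWeights, ← layerWeights_eq]
    simp only [layerWeights, Pi.zero_apply, nz_zero, Finset.sum_const_zero, zero_add]
    refine (Finset.sum_le_sum fun k _ => nz_le_one _).trans ?_
    simp [sq]
  · ext i j
    simp [MNN.realize, MatTensor.apply]

lemma exists_mnn_two_terms_inverse (ϱ : ℝ → ℝ) (n : ℕ) {ε α δ : ℝ} (hα : α ≠ 0) (hδ₁ : δ < 1)
    (h : δ ^ 2 ≤ ε / (2 * |α|) * (1 - δ)) (hε : 0 < ε) :
    ∃ Φ : MNN ϱ n n n n, Φ.numWeights = 2 * (n ^ 2 + n) ∧ Φ.numLayers = 2 ∧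
      ∀ A : Matrix (Fin n) (Fin n) ℝ, ‖1 - α • A‖ ≤ δ → ‖A⁻¹ - Φ.realize A‖ ≤ ε := by
  obtain ⟨Φ, hW, hL, hΦ⟩ := exists_mnn_two_terms ϱ n hα
  refine ⟨Φ, hW, hL, fun A hA => ?_⟩
  rw [hΦ]
  refine norm_inverse_sub_smul_le hα hδ₁ hA _ fun S hS => ?_
  have h1 := norm_inverse_sub_scaledNeumann_le (norm_matrix_one_le n) hδ₁ hA hS 1
  have e : (2 : ℝ) ^ 1 • scaledNeumann (1 - α • A) 1 = 1 + (1 - α • A) := by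
    simp [scaledNeumann, smul_smul]
  rw [e] at h1
  refine h1.trans ?_
  have hα' := abs_pos.2 hα
  rw [pow_one, div_le_iff₀ (by linarith)]
  refine h.trans (mul_le_mul_of_nonneg_right ?_ (by linarith))
  gcongr
  linarith

/-- All inverses of `αA` lie in one ball of radius `δ/(1 - δ²)`, and its centre is the constant
used. The radius is at most `η = ε/|α|`, because `η(1 - δ²) ≥ (1 + δ)/2 ≥ δ`. -/
lemma exists_mnn_const_inverse (ϱ : ℝ → ℝ) (n : ℕ) {ε α δ : ℝ} (hα : α ≠ 0) (hδ₀ : 0 < δ)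
    (hδ₁ : δ < 1) (h : 1 / 2 ≤ ε / |α| * (1 - δ)) :
    ∃ Φ : MNN ϱ n n n n, Φ.numWeights ≤ n ^ 2 ∧ Φ.numLayers = 1 ∧
      ∀ A : Matrix (Fin n) (Fin n) ℝ, ‖1 - α • A‖ ≤ δ → ‖A⁻¹ - Φ.realize A‖ ≤ ε := by
  obtain ⟨Φ, hW, hL, hΦ⟩ := exists_mnn_const ϱ n (α * (1 - δ ^ 2)⁻¹)
  refine ⟨Φ, hW, hL, fun A hA => ?_⟩
  rw [hΦ, mul_smul]
  refine norm_inverse_sub_smul_le hα hδ₁ hA _ fun S hS => ?_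
  refine (norm_inverse_sub_smul_one_le hδ₀.le hδ₁ hA hS).trans ?_
  rw [div_le_iff₀ (by nlinarith)]
  nlinarith

lemma exists_mnn_neumann_inverse {ϱ : ℝ → ℝ} {n ℓ W : ℕ} {E ε α δ : ℝ}
    {g : ((Fin n × Fin n) ⊕ (Fin n × Fin n) → ℝ) → Fin n × Fin n → ℝ} (hg : Chain ϱ ℓ W g)
    (hgE : NormApproxMul E g) (hE₀ : 0 ≤ E) (hε : 0 < ε) (hα : α ≠ 0) (hδ₀ : 0 < δ) (hδ₁ : δ < 1)
    (i : ℕ) (hη : ε / |α| * (1 - δ) < 1 / 2) (hN : δ ^ 2 ^ (i + 2) ≤ ε / |α| / 2 * (1 - δ))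
    (hE : E ≤ (2 ^ 2 ^ (i + 1))⁻¹ * (min (ε / |α|) (1 / 4) / 4)) :
    ∃ Φ : MNN ϱ n n n n, Φ.numLayers = (i + 2) * (ℓ + 1) + 1 ∧
      Φ.numWeights ≤ (ℓ + 10 + 5 * i) * n ^ 2 + 2 * (i + 1) * W ∧
      ∀ A : Matrix (Fin n) (Fin n) ℝ, ‖1 - α • A‖ ≤ δ → ‖A⁻¹ - Φ.realize A‖ ≤ ε := by
  obtain ⟨Φ, hL, hW, hΦ⟩ := exists_mnn_inverse hg hgE hE₀ α hδ₁ i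
    (two_pow_mul_error_le hδ₀ hδ₁ hη hN hE)
  refine ⟨Φ, hL, hW, fun A hA => ?_⟩
  obtain ⟨q, hq, hqE⟩ := hΦ A hA
  rw [hq]
  refine norm_inverse_sub_smul_le hα hδ₁ hA _ fun S hS => ?_
  have h1 := norm_inverse_sub_scaledNeumann_le (norm_matrix_one_le n) hδ₁ hA hS (i + 2)
  have h2 : δ ^ 2 ^ (i + 2) / (1 - δ) ≤ ε / |α| / 2 := (div_le_iff₀ (by linarith)).2 hN
  have h3 := final_error_le (div_pos hε (abs_pos.2 hα)) hE₀ hE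
  have h4 : ‖(2 : ℝ) ^ (i + 2) • scaledNeumann (1 - α • A) (i + 2) - (2 : ℝ) ^ (i + 2) • q‖
      ≤ ε / |α| / 2 := by
    rw [← smul_sub, norm_smul, norm_sub_rev, Real.norm_of_nonneg (by positivity)]
    exact (mul_le_mul_of_nonneg_left hqE (by positivity)).trans h3
  have h5 := norm_sub_le_norm_sub_add_norm_sub S
    ((2 : ℝ) ^ (i + 2) • scaledNeumann (1 - α • A) (i + 2)) ((2 : ℝ) ^ (i + 2) • q)
  linarith

/-- The saving `12 · 4^k ≥ 12 n²` in each of the `2(N - 1)` products yields the negative multiple of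
`N`: what remains to check is `26 - 19N ≤ 20 - 14N`. -/
lemma weight_bound {n N M L W k w : ℕ} (hn : 1 ≤ n) (hN : 2 ≤ N) (hk : k = Nat.clog 2 n)
    (hW : W + 12 * 4 ^ k = 7 ^ k * (M + 12))
    (hw : (w : ℝ) ≤ (2 * k + L + 5 * N) * n ^ 2 + 2 * (N - 1) * W) :
    (w : ℝ) ≤ 14 * (n : ℝ) ^ Real.logb 2 7 * ((N : ℝ) - 1) * ((M : ℝ) + 12)
      + (n : ℝ) ^ 2 * ((L : ℝ) - 14 * (N : ℝ) + 20 + 2 * Real.logb 2 n) + (n : ℝ) * ((N : ℝ) + 1) := by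
  have h7 := seven_pow_clog_le hn
  have h4 := sq_le_four_pow_clog n
  have hk' := cast_clog_le hn
  rw [← hk] at h7 h4 hk'
  have hW' : (W : ℝ) + 12 * 4 ^ k = 7 ^ k * (M + 12) := by exact_mod_cast hW
  have hN' : (2 : ℝ) ≤ N := by exact_mod_cast hN
  have hn' : (0 : ℝ) ≤ n := by positivity
  have h1 : (W : ℝ) ≤ 7 * (n : ℝ) ^ Real.logb 2 7 * (M + 12) - 12 * n ^ 2 := by
    have := mul_le_mul_of_nonneg_right h7 (by positivity : (0 : ℝ) ≤ M + 12)
    linarith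
  have h2 := mul_le_mul_of_nonneg_left h1 (by linarith : (0 : ℝ) ≤ 2 * (N - 1))
  have h3 : ((2 * k + L + 5 * N : ℝ)) * n ^ 2
      ≤ (L + 2 * Real.logb 2 n + 2 + 5 * N) * (n : ℝ) ^ 2 :=
    mul_le_mul_of_nonneg_right (by linarith) (by positivity)
  have h5 : 0 ≤ (5 * (N : ℝ) - 6) * (n : ℝ) ^ 2 := mul_nonneg (by linarith) (by positivity)
  have h6 : 0 ≤ (n : ℝ) * ((N : ℝ) + 1) := by positivity
  linarith

theorem mainTheorem2 (ϱ : ℝ → ℝ) (Pr : ℝ → ℝ → MNN ϱ 1 2 1 1) (hPr : ApproximatesProduct Pr)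
    (ε α δ : ℝ) (hε : 0 < ε) (hα : α ≠ 0) (hδ₀ : 0 < δ) (hδ₁ : δ < 1) (n : ℕ) (hn : 1 ≤ n) :
    ∃ Φ : MNN ϱ n n n n,
      (∀ A : Matrix (Fin n) (Fin n) ℝ, ‖1 - α • A‖ ≤ δ →
        IsUnit A ∧ ‖A⁻¹ - Φ.realize A‖ ≤ ε) ∧
      (2 ≤ neumannLevel (ε / (2 * |α|)) δ →
        (Φ.numWeights : ℝ) ≤
          14 * (n : ℝ) ^ Real.logb 2 7 * ((neumannLevel (ε / (2 * |α|)) δ : ℝ) - 1) *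
              (((Pr (productAccuracy (ε / |α|) δ n) (2 * n)).numWeights : ℝ) + 12)
            + (n : ℝ) ^ 2 *
              (((Pr (productAccuracy (ε / |α|) δ n) (2 * n)).numLayers : ℝ)
                - 14 * (neumannLevel (ε / (2 * |α|)) δ : ℝ) + 20 + 2 * Real.logb 2 n)
            + (n : ℝ) * ((neumannLevel (ε / (2 * |α|)) δ : ℝ) + 1) ∧
        (Φ.numLayers : ℝ) ≤
          (neumannLevel (ε / (2 * |α|)) δ : ℝ) *
            (2 * Real.logb 2 n + 5 +
              ((Pr (productAccuracy (ε / |α|) δ n) (2 * n)).numLayers : ℝ))) ∧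
      (neumannLevel (ε / (2 * |α|)) δ = 1 →
        Φ.numWeights = 2 * (n ^ 2 + n) ∧ Φ.numLayers = 2) := by
  have hα' := abs_pos.2 hα
  have hη : 0 < ε / |α| := div_pos hε hα'
  have hη2 : ε / (2 * |α|) = ε / |α| / 2 := by
    rw [div_div, mul_comm]
  have hpow := pow_neumannLevel_le (e := ε / (2 * |α|)) (by positivity) hδ₀ hδ₁
  have hN1 := one_le_neumannLevel (ε / (2 * |α|)) δ
  have hlev := neumannLevel_half_le hη hδ₀ hδ₁
  rw [← hη2] at hlev
  have hn' : (1 : ℝ) ≤ n := by exact_mod_cast hn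
  have hK : (0 : ℝ) < 2 * n := by linarith
  have hmin : 0 < min (ε / |α|) (1 / 4) := lt_min hη (by norm_num)
  have hσ : 0 < productAccuracy (ε / |α|) δ n := by
    unfold productAccuracy
    positivity
  obtain ⟨W, g, hg, hW, hgK⟩ := (Pr (productAccuracy (ε / |α|) δ n) (2 * n)).exists_mul_chain hK.le
    hσ.le (hPr _ _ hσ hK) (Nat.le_pow_clog one_lt_two n)
  set P := Pr (productAccuracy (ε / |α|) δ n) (2 * n)
  set N := neumannLevel (ε / (2 * |α|)) δ
  have hL1 : (1 : ℝ) ≤ P.numLayers := by exact_mod_cast P.numLayers_pos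
  have hlog : 0 ≤ Real.logb 2 n := Real.logb_nonneg one_lt_two hn'
  rcases hN1.eq_or_lt with h1 | h2
  · rw [← h1, pow_one] at hpow
    obtain ⟨Φ, hw, hl, hΦ⟩ := exists_mnn_two_terms_inverse ϱ n hα hδ₁ hpow hε
    exact ⟨Φ, fun A hA => ⟨isUnit_of_norm_one_sub_smul_le hδ₁ hA, hΦ A hA⟩, fun h => by omega,
      fun _ => ⟨hw, hl⟩⟩
  have hN2 : (2 : ℝ) ≤ N := by exact_mod_cast h2
  -- Below `1/2` the prescribed accuracy is fine enough for `N` rounds; from `1/2` on it need not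
  -- be, and the constant network takes over.
  rcases le_or_gt (1 / 2) (ε / |α| * (1 - δ)) with h | h
  · obtain ⟨Φ, hw, hl, hΦ⟩ := exists_mnn_const_inverse ϱ n hα hδ₀ hδ₁ h
    refine ⟨Φ, fun A hA => ⟨isUnit_of_norm_one_sub_smul_le hδ₁ hA, hΦ A hA⟩, fun _ => ⟨?_, ?_⟩,
      fun h => by omega⟩
    · refine weight_bound hn h2 rfl hW ?_
      have hw' : (Φ.numWeights : ℝ) ≤ 1 * (n : ℝ) ^ 2 := by
        rw [one_mul]
        exact_mod_cast hw
      refine hw'.trans (le_add_of_le_of_nonneg (mul_le_mul_of_nonneg_right ?_ (by positivity)) ?_)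
      · have : (0 : ℝ) ≤ Nat.clog 2 n := by positivity
        linarith
      · exact mul_nonneg (by linarith) (by positivity)
    · rw [hl]
      push_cast
      nlinarith
  · obtain ⟨i, hi⟩ : ∃ i, N = i + 2 := ⟨N - 2, by omega⟩
    have h4 : (4 : ℝ) ^ Nat.clog 2 n * productAccuracy (ε / |α|) δ n
        ≤ 4 * n ^ 2 * productAccuracy (ε / |α|) δ n :=
      mul_le_mul_of_nonneg_right (four_pow_clog_le hn) hσ.le
    -- The range `2n` of the scalar network leaves `2n / 2^k ≥ 1` after `k` Strassen steps, enough
    -- for contractions.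
    have hgE := (hgK.mono le_rfl h4).normApproxMul (by positivity) (by
      rw [le_div_iff₀ (by positivity), one_mul]
      exact_mod_cast two_pow_clog_le hn)
    -- The factor `4n²` from Strassen and `n` from the passage to the operator norm turn `16n³` into
    -- `4`.
    have hE : n * (4 * n ^ 2 * productAccuracy (ε / |α|) δ n)
        ≤ (2 ^ 2 ^ (i + 1))⁻¹ * (min (ε / |α|) (1 / 4) / 4) := by
      have e : n * (4 * n ^ 2 * productAccuracy (ε / |α|) δ n)
          = (2 ^ 2 ^ neumannLevel (ε / |α|) δ)⁻¹ * (min (ε / |α|) (1 / 4) / 4) := by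
        unfold productAccuracy
        field_simp
        norm_num
      rw [e]
      refine mul_le_mul_of_nonneg_right ?_ (by positivity)
      have : i + 1 ≤ neumannLevel (ε / |α|) δ := by
        have := hlev h
        omega
      gcongr <;> norm_num
    rw [hi, hη2] at hpow
    obtain ⟨Φ, hl, hw, hΦ⟩ := exists_mnn_neumann_inverse hg hgE (by positivity) hε hα hδ₀ hδ₁ i h
      hpow hE
    refine ⟨Φ, fun A hA => ⟨isUnit_of_norm_one_sub_smul_le hδ₁ hA, hΦ A hA⟩, fun _ => ⟨?_, ?_⟩,
      fun h => by omega⟩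
    · refine weight_bound hn h2 rfl hW ?_
      refine ((Nat.cast_le (α := ℝ)).2 hw).trans (le_of_eq ?_)
      rw [hi]
      push_cast
      ring
    · have hk := cast_clog_le hn
      have e : (Φ.numLayers : ℝ) = N * (2 * Nat.clog 2 n + P.numLayers + 1) + 1 := by
        rw [hl, hi]
        push_cast
        ring
      rw [e]
      nlinarith
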